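/- All Banach spaces are real and separable, and operators are bounded linear maps. An operator $T$ is nonexpansive if $\|T\|\le 1$. For $\varepsilon>0$, an $\varepsilon$-isometric embedding is an injective operator $T:X\to Y$ with $(1-\varepsilon)\|x\|<\|Tx\|<(1+\varepsilon)\|x\|$ for all $x\ne0$. A Banach space $\mathbb G$ is Gurarii if for all finite-dimensional Banach spaces $A\subseteq B$ and every $\varepsilon>0$, every isometric embedding $A\to\mathbb G$ extends to an $\varepsilon$-isometric embedding $B\to\mathbb G$. An operator $G:X\to Y$ is a Gurarii operator if it is nonexpansive and, for every $\varepsilon>0$, every nonexpansive operator $T:A\to B$ between finite-dimensional Banach spaces, all subspaces $A_0\subseteq A$, $B_0\subseteq B$ with $T[A_0]\subseteq B_0$ and all isometric embeddings $i_0:A_0\to X$, $j_0:B_0\to Y$ with $G\circ i_0=j_0\circ T{\restriction}_{A_0}$, there are $\varepsilon$-isometric embeddings $i:A\to X$, $j:B\to Y$ with $i{\restriction}_{A_0}=i_0$, $j{\restriction}_{B_0}=j_0$ and $G\circ i=j\circ T$. For an operator $T:X\to Y$ let $\|T^{\leftarrow}\|\in[0,\infty]$ be the infimum of all $r\ge0$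 with $T[X]\cap B_Y(1)\subseteq T[B_X(r)]$, where $B(r)$ is the open ball of radius $r$ centred at $0$; it is finite when $X$ is finite-dimensional. For $\varepsilon,n,m,t\ge 0$ let $\delta(\varepsilon,n,m,t)$ be the largest real $\delta$ with $\delta\bigl(1+(1+\delta)(n+1)\max\{1,t\sqrt{nm}\}\bigr)\le\varepsilon$. A rational Banach space is $\mathbb R^n$ ($n\ge0$) with a norm whose closed unit ball is the convex hull of a finite subset of $\mathbb Q^n$; $E_X$ denotes the standard unit basis of $X=\mathbb R^n$, and a standard subspace of $X$ is the linear hull of a subset of $E_X$. A linear map $T:\mathbb R^n\to\mathbb R^m$ is standard if for some $k$ with $0\le n-k\le m$ it is given by $(Tx)_i=x_{i+k}$ for $0\le i<n-k$ and $(Tx)_i=0$ for $n-k\le i<m$ (coordinates indexed from $0$). **Theorem.** Let $\mathbb G$ be the (separable) Gurarii space and $D\subseteq\mathbb G$ a countable dense set. Let $\mathcal F_D$ be the family of all tuples $(\varepsilon,X,Y,T,X_0,Y_0,T_0,i_0,j_0)$ consisting of a rational $\varepsilon\in(0,1]$; rational Banach spaces $X,Y$; a nonexpansive standard operator $T:X\to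 Y$; standard subspaces $X_0\subseteq X$, $Y_0\subseteq Y$ with $T[X_0]\subseteq Y_0$; the restriction $T_0=T{\restriction}_{X_0}:X_0\to Y_0$; and $\delta(\varepsilon,\dim X_0,\dim Y_0,\|T_0^{\leftarrow}\|)$-isometric embeddings $i_0:X_0\to\mathbb G$, $j_0:Y_0\to\mathbb G$ with $i_0(E_X\cap X_0)\cup j_0(E_Y\cap Y_0)\subseteq D$. Then the family $\mathcal F_D$ is countable, and a nonexpansive operator $G:\mathbb G\to\mathbb G$ is Gurarii if and only if it satisfies the condition (GC) for every $(\varepsilon,X,Y,T,X_0,Y_0,T_0,i_0,j_0)\in\mathcal F_D$ with $\|G\circ i_0-j_0\circ T_0\|<\delta(\varepsilon,\dim X_0,\dim Y_0,\|T_0^{\leftarrow}\|)$ there exist $\varepsilon$-isometric embeddings $i:X\to\mathbb G$ and $j:Y\to\mathbb G$ such that $$\|i{\restriction}_{X_0}-i_0\|<\varepsilon,\qquad \|j{\restriction}_{Y_0}-j_0\|<\varepsilon,\qquad \|G\circ i-j\circ T\|<\varepsilon.$$ -/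

import Mathlib

open scoped NNReal ENNReal

namespace GurariiOp

section Embeddings

variable {X Y : Type*} [NormedAddCommGroup X] [NormedSpace ℝ X]
  [NormedAddCommGroup Y] [NormedSpace ℝ Y]

/-- An `ε`-isometric embedding: an injective bounded operator `T` with
`(1 - ε)‖x‖ < ‖T x‖ < (1 + ε)‖x‖` for every nonzero `x`. -/
def IsEpsIsometricEmbedding (ε : ℝ) (T : X →L[ℝ] Y) : Prop :=
  Function.Injective T ∧ ∀ x : X, x ≠ 0 → (1 - ε) * ‖x‖ < ‖T x‖ ∧ ‖T x‖ < (1 + ε) * ‖x‖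

/-- The openness norm `‖T^←‖ ∈ [0, ∞]`: the infimum (`∞` if there is none) of all `r ≥ 0` such that
`T[X] ∩ B_Y(1) ⊆ T[B_X(r)]`, where `B(r)` is the open ball of radius `r` around `0`. -/
noncomputable def opennessNorm (T : X →L[ℝ] Y) : ℝ≥0∞ :=
  sInf ((fun r : ℝ≥0 => (r : ℝ≥0∞)) ''
      {r : ℝ≥0 | Set.range T ∩ Metric.ball (0 : Y) 1 ⊆ T '' Metric.ball (0 : X) r} ∪ {⊤})

/-- On a finite-dimensional space the openness norm is finite. -/
theorem opennessNorm_ne_top [FiniteDimensional ℝ X] (T : X →L[ℝ] Y) : opennessNorm T ≠ ⊤ := by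
  have : CompleteSpace X := FiniteDimensional.complete ℝ X
  have : FiniteDimensional ℝ (LinearMap.range (T : X →ₗ[ℝ] Y)) := inferInstance
  have : CompleteSpace (LinearMap.range (T : X →ₗ[ℝ] Y)) := FiniteDimensional.complete ℝ _
  let S : X →L[ℝ] (LinearMap.range (T : X →ₗ[ℝ] Y)) :=
    T.codRestrict _ (fun x => LinearMap.mem_range_self (T : X →ₗ[ℝ] Y) x)
  have hS : Function.Surjective S := by
    rintro ⟨_, x, rfl⟩
    exact ⟨x, rfl⟩
  obtain ⟨C, hC, h⟩ := S.exists_preimage_norm_le hS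
  have hmem : (⟨C, hC.le⟩ : ℝ≥0) ∈
      {r : ℝ≥0 | Set.range T ∩ Metric.ball (0 : Y) 1 ⊆ T '' Metric.ball (0 : X) r} := by
    rintro y ⟨⟨x, rfl⟩, hy⟩
    obtain ⟨z, hz, hz'⟩ := h (S x)
    have h1 : ‖S x‖ < 1 := mem_ball_zero_iff.mp hy
    refine ⟨z, ?_, congrArg Subtype.val hz⟩
    have : ‖z‖ < C := hz'.trans_lt (by nlinarith)
    exact mem_ball_zero_iff.mpr this
  exact ne_top_of_le_ne_top ENNReal.coe_ne_top
    (sInf_le (Or.inl ⟨_, hmem, rfl⟩))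

end Embeddings

/-- `δ(ε, n, m, t)` is the largest real `δ` with
`δ (1 + (1 + δ)(n + 1) max{1, t √(nm)}) ≤ ε`. -/
noncomputable def delta (ε n m t : ℝ) : ℝ :=
  sSup {d : ℝ | d * (1 + (1 + d) * (n + 1) * max 1 (t * √(n * m))) ≤ ε}

/-- The supremum in the definition of `delta` is attained, so it is a largest element. -/
theorem isGreatest_delta {ε n : ℝ} (m t : ℝ) (hε : 0 ≤ ε) (hn : 0 ≤ n) :
    IsGreatest {d : ℝ | d * (1 + (1 + d) * (n + 1) * max 1 (t * √(n * m))) ≤ ε}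
      (delta ε n m t) := by
  have hM : (1 : ℝ) ≤ max 1 (t * √(n * m)) := le_max_left _ _
  set M := max 1 (t * √(n * m)) with hMdef
  have hc : 1 ≤ (n + 1) * M := by nlinarith
  have hne : {d : ℝ | d * (1 + (1 + d) * (n + 1) * M) ≤ ε}.Nonempty := ⟨0, by simpa using hε⟩
  have hbdd : BddAbove {d : ℝ | d * (1 + (1 + d) * (n + 1) * M) ≤ ε} := by
    refine ⟨ε, fun d hd => ?_⟩
    rcases le_total d 0 with h | h
    · exact h.trans hε
    · have hd' : d * (1 + (1 + d) * (n + 1) * M) ≤ ε := hd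
      have : 0 ≤ d * ((1 + d) * ((n + 1) * M)) := by positivity
      nlinarith
  have hcl : IsClosed {d : ℝ | d * (1 + (1 + d) * (n + 1) * M) ≤ ε} :=
    isClosed_le (by fun_prop) continuous_const
  exact ⟨hcl.csSup_mem hne hbdd, fun d hd => le_csSup hbdd hd⟩

/-- A Banach space `X` is Gurarii if for all finite-dimensional Banach spaces `A ⊆ B` and every
`ε > 0`, every isometric embedding `A → X` extends to an `ε`-isometric embedding `B → X`. -/
def IsGurariiSpace (X : Type*) [NormedAddCommGroup X] [NormedSpace ℝ X] : Prop :=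
  ∀ (B : Type) [NormedAddCommGroup B] [NormedSpace ℝ B] [FiniteDimensional ℝ B]
    (A : Submodule ℝ B) (ε : ℝ), 0 < ε → ∀ i₀ : A →ₗᵢ[ℝ] X,
      ∃ i : B →L[ℝ] X, IsEpsIsometricEmbedding ε i ∧ ∀ a : A, i a = i₀ a

/-- A nonexpansive operator `G : X → Y` is Gurarii if for every `ε > 0`, every nonexpansive operator
`T : A → B` of finite-dimensional Banach spaces, all subspaces `A₀ ⊆ A`, `B₀ ⊆ B` with
`T[A₀] ⊆ B₀`, and all isometric embeddings `i₀ : A₀ → X`, `j₀ : B₀ → Y` with `G ∘ i₀ = j₀ ∘ T|A₀`,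
there are `ε`-isometric embeddings `i`, `j` extending `i₀`, `j₀` with `G ∘ i = j ∘ T`. -/
def IsGurariiOperator {X Y : Type*} [NormedAddCommGroup X] [NormedSpace ℝ X]
    [NormedAddCommGroup Y] [NormedSpace ℝ Y] (G : X →L[ℝ] Y) : Prop :=
  ‖G‖ ≤ 1 ∧
  ∀ (ε : ℝ), 0 < ε →
  ∀ (A B : Type) [NormedAddCommGroup A] [NormedSpace ℝ A] [FiniteDimensional ℝ A]
    [NormedAddCommGroup B] [NormedSpace ℝ B] [FiniteDimensional ℝ B]
    (T : A →L[ℝ] B), ‖T‖ ≤ 1 →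
  ∀ (A₀ : Submodule ℝ A) (B₀ : Submodule ℝ B) (hT : ∀ a ∈ A₀, T a ∈ B₀)
    (i₀ : A₀ →ₗᵢ[ℝ] X) (j₀ : B₀ →ₗᵢ[ℝ] Y),
    (∀ a : A₀, G (i₀ a) = j₀ ⟨T a, hT a a.2⟩) →
    ∃ (i : A →L[ℝ] X) (j : B →L[ℝ] Y),
      IsEpsIsometricEmbedding ε i ∧ IsEpsIsometricEmbedding ε j ∧
      (∀ a : A₀, i a = i₀ a) ∧ (∀ b : B₀, j b = j₀ b) ∧ G ∘L i = j ∘L T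

/-- A rational norm on `ℝⁿ`: a norm whose closed unit ball is the convex hull of a finite
set of points with rational coordinates. -/
structure RationalNorm (n : ℕ) extends Seminorm ℝ (Fin n → ℝ) where
  eq_zero_of_map_eq_zero' : ∀ x, toFun x = 0 → x = 0
  rational' : ∃ F : Finset (Fin n → ℚ),
    {x | toFun x ≤ 1} =
      convexHull ℝ ((fun (q : Fin n → ℚ) (i : Fin n) => (q i : ℝ)) '' (F : Set (Fin n → ℚ)))

/-- The rational Banach space `ℝⁿ` with the rational norm `p`. -/
def RationalNorm.Space {n : ℕ} (_p : RationalNorm n) : Type := Fin n → ℝ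

namespace RationalNorm

variable {n m : ℕ} (p : RationalNorm n) (q : RationalNorm m)

instance : AddCommGroup p.Space := inferInstanceAs (AddCommGroup (Fin n → ℝ))

instance : Module ℝ p.Space := inferInstanceAs (Module ℝ (Fin n → ℝ))

instance : FiniteDimensional ℝ p.Space := inferInstanceAs (FiniteDimensional ℝ (Fin n → ℝ))

/-- The identity map from `ℝⁿ` with the norm `p` to the plain coordinate space. -/
def coord : p.Space ≃ₗ[ℝ] (Fin n → ℝ) := LinearEquiv.refl ℝ (Fin n → ℝ)

noncomputable instance : NormedAddCommGroup p.Space :=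
  AddGroupNorm.toNormedAddCommGroup
    { toFun := fun x => p.toSeminorm (p.coord x)
      map_zero' := map_zero p.toSeminorm
      add_le' := fun x y => map_add_le_add p.toSeminorm (p.coord x) (p.coord y)
      neg' := fun x => map_neg_eq_map p.toSeminorm (p.coord x)
      eq_zero_of_map_eq_zero' := fun x hx => p.eq_zero_of_map_eq_zero' x hx }

theorem norm_def (x : p.Space) : ‖x‖ = p.toSeminorm (p.coord x) := rfl

noncomputable instance : NormedSpace ℝ p.Space where
  norm_smul_le c x := (map_smul_eq_mul p.toSeminorm c (p.coord x)).le

/-- The `i`-th vector of the standard unit basis. -/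
noncomputable def stdVec (i : Fin n) : p.Space := p.coord.symm (Pi.single i 1)

/-- A linear subspace of `ℝⁿ` is standard if it is the linear hull of some set of
standard unit vectors. -/
def IsStandardSubspace (X₀ : Submodule ℝ p.Space) : Prop :=
  ∃ S : Set (Fin n), X₀ = Submodule.span ℝ (p.stdVec '' S)

/-- An operator `T : ℝⁿ → ℝᵐ` is standard if for some `k` with `0 ≤ n - k ≤ m` it maps `x` to the
vector whose `i`-th coordinate is `x (i + k)` for `i < n - k` and `0` for the other `i`. -/
def IsStandardOperator {p : RationalNorm n} {q : RationalNorm m} (T : p.Space →L[ℝ] q.Space) :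
    Prop :=
  ∃ k : ℕ, k ≤ n ∧ n - k ≤ m ∧ ∀ (x : p.Space) (i : Fin m),
    q.coord (T x) i =
      if h : (i : ℕ) < n - k then p.coord x ⟨(i : ℕ) + k, Nat.add_lt_of_lt_sub h⟩ else 0

end RationalNorm

/-- The family `F_D` of tuples `(ε, X, Y, T, X₀, Y₀, T₀, i₀, j₀)`. -/
structure StandardTuple {𝔾 : Type*} [NormedAddCommGroup 𝔾] [NormedSpace ℝ 𝔾] (D : Set 𝔾) where
  ε : ℚ
  ε_pos : 0 < ε
  ε_le_one : ε ≤ 1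
  {dimX : ℕ}
  {dimY : ℕ}
  X : RationalNorm dimX
  Y : RationalNorm dimY
  T : X.Space →L[ℝ] Y.Space
  T_nonexpansive : ‖T‖ ≤ 1
  T_standard : RationalNorm.IsStandardOperator T
  X₀ : Submodule ℝ X.Space
  Y₀ : Submodule ℝ Y.Space
  X₀_standard : X.IsStandardSubspace X₀
  Y₀_standard : Y.IsStandardSubspace Y₀
  /-- The restriction of `T`, which exists only if `T` maps `X₀` into `Y₀`. -/
  T₀ : X₀ →L[ℝ] Y₀
  T₀_apply : ∀ x : X₀, (T₀ x : Y.Space) = T x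
  i₀ : X₀ →L[ℝ] 𝔾
  j₀ : Y₀ →L[ℝ] 𝔾
  i₀_isometric : IsEpsIsometricEmbedding
    (delta ε (Module.finrank ℝ X₀) (Module.finrank ℝ Y₀) (opennessNorm T₀).toReal) i₀
  j₀_isometric : IsEpsIsometricEmbedding
    (delta ε (Module.finrank ℝ X₀) (Module.finrank ℝ Y₀) (opennessNorm T₀).toReal) j₀
  i₀_mem : ∀ x : X₀, (x : X.Space) ∈ Set.range X.stdVec → i₀ x ∈ D
  j₀_mem : ∀ y : Y₀, (y : Y.Space) ∈ Set.range Y.stdVec → j₀ y ∈ D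

/-- The condition (GC): approximate extension for all tuples in `F_D`. -/
def ConditionGC {𝔾 : Type*} [NormedAddCommGroup 𝔾] [NormedSpace ℝ 𝔾] (D : Set 𝔾)
    (G : 𝔾 →L[ℝ] 𝔾) : Prop :=
  ∀ t : StandardTuple D,
    ‖G ∘L t.i₀ - t.j₀ ∘L t.T₀‖ <
      delta t.ε (Module.finrank ℝ t.X₀) (Module.finrank ℝ t.Y₀) (opennessNorm t.T₀).toReal →
    ∃ (i : t.X.Space →L[ℝ] 𝔾) (j : t.Y.Space →L[ℝ] 𝔾),
      IsEpsIsometricEmbedding t.ε i ∧ IsEpsIsometricEmbedding t.ε j ∧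
      ‖i ∘L t.X₀.subtypeL - t.i₀‖ < t.ε ∧ ‖j ∘L t.Y₀.subtypeL - t.j₀‖ < t.ε ∧
      ‖G ∘L i - j ∘L t.T‖ < t.ε

end GurariiOp

/-!
Countability holds because a rational norm is determined by a finite set of rational points, and
the remaining data of a tuple are either rational, combinatorial, or finitely many values in `D`.

**A Gurarii operator satisfies (GC).** Let `δ = δ(ε, dim X₀, dim Y₀, ‖T₀^←‖)`. Only `0 < 2δ < ε` is
needed. Let `Z` be the range of `i₀` and `W ⊆ 𝔾` the subspace spanned by the range of `j₀` and
`G[Z]`. The direct sum `X ⊕ Z` carries the norm `inf_u (‖x - u‖ + ‖z + i₀ u‖ + 2δ‖u‖)`, under which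
`X` and `Z` are isometrically embedded and `u`, `i₀ u` are at distance at most `2δ‖u‖`; similarly
`Y ⊕ W`, with `δ` in place of `2δ` (`exists_amalgam`). As `‖G ∘ i₀ - j₀ ∘ T₀‖ < δ`, the operator
`T ⊕ G` is nonexpansive between these amalgams. The inclusions of `Z` and `W` in `𝔾` commute with
it, and the extensions supplied by the Gurarii property restrict to the required `i` and `j`.

**(GC) implies that `G` is a Gurarii operator.** Since `𝔾` is a Gurarii space, `j₀` can be extended
first. What remains is to lift a nonexpansive operator `S : A → 𝔾` to an almost isometric `i` with
`G ∘ i = S` and `i = i₀` on `A₀` (`ConditionGC.exists_isometric_lift`).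

* *Approximate lifts* (`ConditionGC.exists_approx_extension`). A basis of `A` adapted to `ker S` and
  `A₀` makes `S : A → S[A]` standard and `A₀` a standard subspace. The norms are replaced by nearby
  rational ones that keep `S` nonexpansive, and the basis vectors are sent into `D`. The openness
  norm stays bounded during this approximation, so `δ` stays away from zero and (GC) applies.
* *Exact lifts* (`ConditionGC.exists_better_lift`, `ConditionGC.exists_exact_lift`). Let `i` be a
  lift with error `‖G ∘ i - S‖ ≤ e` that is exact on `A₀`, and let `P` be a projection onto `A₀`.
  Approximate lifting, applied to the `ℓ¹`-sum of `Z = i[A]` and `A` with the operator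
  `(z, a) ↦ G z + e⁻¹ (S a - G (i a))` that sends `(i a, e (a - P a))` to `S a`, gives a lift
  with arbitrarily small error at distance `O(e)` from `i`. Iteration yields a convergent sequence,
  whose limit is an exact lift close to the initial one. The initial lift, corrected on `A₀`, is
  almost isometric, and hence so is the limit.
-/

namespace GurariiOp

/-! ### Countability of the family of standard tuples -/

theorem seminorm_le_of_unitBall_subset {E : Type*} [AddCommGroup E] [Module ℝ E]
    {p q : Seminorm ℝ E} (h : ∀ x, p x ≤ 1 → q x ≤ 1) (x : E) : q x ≤ p x := by
  refine le_of_forall_gt_imp_ge_of_dense fun c hc => ?_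
  have hc0 : 0 < c := (apply_nonneg p x).trans_lt hc
  have h1 : p (c⁻¹ • x) ≤ 1 := by
    rw [map_smul_eq_mul, Real.norm_of_nonneg (inv_nonneg.2 hc0.le), inv_mul_le_one₀ hc0]
    exact hc.le
  have h2 := h _ h1
  rwa [map_smul_eq_mul, Real.norm_of_nonneg (inv_nonneg.2 hc0.le), inv_mul_le_one₀ hc0] at h2

namespace RationalNorm

theorem toSeminorm_injective {n : ℕ} :
    Function.Injective (toSeminorm : RationalNorm n → Seminorm ℝ (Fin n → ℝ)) := by
  rintro ⟨p, _, _⟩ ⟨q, _, _⟩ h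
  cases h
  rfl

/-- A rational norm is determined by the finite set of rational points spanning its unit ball. -/
instance instCountable (n : ℕ) : Countable (RationalNorm n) := by
  choose F hF using fun p : RationalNorm n => p.rational'
  refine Function.Injective.countable (f := F) fun p q h => toSeminorm_injective ?_
  have hpq : ∀ x, p.toSeminorm x ≤ 1 ↔ q.toSeminorm x ≤ 1 := by
    have h' : {x | p.toFun x ≤ 1} = {x | q.toFun x ≤ 1} := by rw [hF p, hF q, h]
    exact fun x => Set.ext_iff.1 h' x
  ext x
  exact le_antisymm (seminorm_le_of_unitBall_subset (fun x => (hpq x).2) x)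
    (seminorm_le_of_unitBall_subset (fun x => (hpq x).1) x)

variable {n m : ℕ} (p : RationalNorm n) (q : RationalNorm m)

instance countable_standardOperator :
    Countable {T : p.Space →L[ℝ] q.Space // IsStandardOperator T} := by
  choose k hk hkm h using fun T : {T : p.Space →L[ℝ] q.Space // IsStandardOperator T} => T.2
  refine Function.Injective.countable (f := k) fun T S hTS => Subtype.ext ?_
  ext x
  refine q.coord.injective (funext fun i => ?_)
  have h1 := h T x i
  have h2 := h S x i
  simp only [hTS] at h1
  exact h1.trans h2.symm

instance countable_standardSubspace :
    Countable {X₀ : Submodule ℝ p.Space // p.IsStandardSubspace X₀} := by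
  choose S hS using fun X₀ : {X₀ : Submodule ℝ p.Space // p.IsStandardSubspace X₀} => X₀.2
  exact Function.Injective.countable (f := S) fun X₀ X₁ h =>
    Subtype.ext (by rw [hS X₀, hS X₁, h])

variable {p}

/-- An operator on a standard subspace is determined by its values on the standard vectors that
the subspace contains. -/
theorem IsStandardSubspace.continuousLinearMap_ext {X₀ : Submodule ℝ p.Space}
    (h : p.IsStandardSubspace X₀) {F : Type*} [NormedAddCommGroup F] [NormedSpace ℝ F]
    {f g : X₀ →L[ℝ] F}
    (hfg : ∀ i (hi : p.stdVec i ∈ X₀), f ⟨p.stdVec i, hi⟩ = g ⟨p.stdVec i, hi⟩) : f = g := by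
  obtain ⟨S, rfl⟩ := h
  ext ⟨x, hx⟩
  induction hx using Submodule.span_induction with
  | mem x hx =>
    obtain ⟨i, hi, rfl⟩ := hx
    exact hfg i _
  | zero => exact (map_zero f).trans (map_zero g).symm
  | add x y hx hy h1 h2 =>
    exact (map_add f ⟨x, hx⟩ ⟨y, hy⟩).trans
      ((congrArg₂ (· + ·) h1 h2).trans (map_add g ⟨x, hx⟩ ⟨y, hy⟩).symm)
  | smul a x hx h1 =>
    exact (map_smul f a ⟨x, hx⟩).trans
      ((congrArg (a • ·) h1).trans (map_smul g a ⟨x, hx⟩).symm)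

end RationalNorm

variable {𝔾 : Type*} [NormedAddCommGroup 𝔾] [NormedSpace ℝ 𝔾] {D : Set 𝔾}

open Classical in
/-- The values of an operator on the standard vectors of its domain, with `0` at the remaining
indices. -/
noncomputable def stdValues {n : ℕ} {p : RationalNorm n} {X₀ : Submodule ℝ p.Space}
    (f : X₀ →L[ℝ] 𝔾) (hf : ∀ x : X₀, (x : p.Space) ∈ Set.range p.stdVec → f x ∈ D)
    (i : Fin n) : (insert 0 D : Set 𝔾) :=
  if h : p.stdVec i ∈ X₀ then ⟨f ⟨p.stdVec i, h⟩, Or.inr (hf _ ⟨i, rfl⟩)⟩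
  else ⟨0, Or.inl rfl⟩

theorem eq_of_stdValues_eq {n : ℕ} {p : RationalNorm n} {X₀ : Submodule ℝ p.Space}
    (h₀ : p.IsStandardSubspace X₀) {f g : X₀ →L[ℝ] 𝔾}
    {hf : ∀ x : X₀, (x : p.Space) ∈ Set.range p.stdVec → f x ∈ D}
    {hg : ∀ x : X₀, (x : p.Space) ∈ Set.range p.stdVec → g x ∈ D}
    (h : stdValues f hf = stdValues g hg) : f = g := by
  refine h₀.continuousLinearMap_ext fun i hi => ?_
  have := congrArg Subtype.val (congrFun h i)
  simpa [stdValues, hi] using this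

theorem countable_standardTuple (hD : D.Countable) : Countable (StandardTuple D) := by
  have : Countable (insert 0 D : Set 𝔾) := (hD.insert 0).to_subtype
  let Code := Σ (N : ℕ × ℕ) (P : RationalNorm N.1 × RationalNorm N.2),
    ℚ × {T : P.1.Space →L[ℝ] P.2.Space // RationalNorm.IsStandardOperator T} ×
      {X₀ : Submodule ℝ P.1.Space // P.1.IsStandardSubspace X₀} ×
      {Y₀ : Submodule ℝ P.2.Space // P.2.IsStandardSubspace Y₀} ×
      (Fin N.1 → (insert 0 D : Set 𝔾)) × (Fin N.2 → (insert 0 D : Set 𝔾))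
  let code : StandardTuple D → Code := fun t =>
    ⟨(t.dimX, t.dimY), (t.X, t.Y), t.ε, ⟨t.T, t.T_standard⟩, ⟨t.X₀, t.X₀_standard⟩,
      ⟨t.Y₀, t.Y₀_standard⟩, stdValues t.i₀ t.i₀_mem, stdValues t.j₀ t.j₀_mem⟩
  have hcode : Function.Injective code := by
    rintro ⟨ε, _, _, X, Y, T, _, _, X₀, Y₀, hX₀, hY₀, T₀, hT₀, i₀, j₀, _, _, hi, hj⟩
      ⟨ε', _, _, X', Y', T', _, _, X₀', Y₀', hX₀', hY₀', T₀', hT₀', i₀', j₀', _, _, hi', hj'⟩ h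
    obtain ⟨h1, h⟩ := Sigma.mk.inj h
    obtain ⟨rfl, rfl⟩ := Prod.mk.inj h1
    obtain ⟨h1, h⟩ := Sigma.mk.inj (eq_of_heq h)
    obtain ⟨rfl, rfl⟩ := Prod.mk.inj h1
    have h := eq_of_heq h
    simp only [Prod.mk.injEq, Subtype.mk.injEq] at h
    obtain ⟨rfl, rfl, rfl, rfl, hi, hj⟩ := h
    obtain rfl := eq_of_stdValues_eq hX₀ hi
    obtain rfl := eq_of_stdValues_eq hY₀ hj
    have : T₀ = T₀' := by
      ext x
      rw [hT₀, hT₀']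
    cases this
    rfl
  exact hcode.countable

/-! ### Exact extension from a Gurarii operator to (GC) -/

/-- A finite-dimensional normed space in any universe is isometric to one in `Type`. -/
theorem exists_linearIsometryEquiv_type0 (A : Type*) [NormedAddCommGroup A] [NormedSpace ℝ A]
    [FiniteDimensional ℝ A] :
    ∃ (A' : Type) (_ : NormedAddCommGroup A') (_ : NormedSpace ℝ A'),
      FiniteDimensional ℝ A' ∧ Nonempty (A' ≃ₗᵢ[ℝ] A) := by
  have : Small.{0} A := small_map (Module.finBasis ℝ A).equivFun.toEquiv
  let e : Shrink.{0} A ≃ₗ[ℝ] A := Shrink.linearEquiv ℝ A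
  let n1 : NormedAddCommGroup (Shrink.{0} A) :=
    NormedAddCommGroup.induced (Shrink.{0} A) A e.toLinearMap e.injective
  let n2 : NormedSpace ℝ (Shrink.{0} A) :=
    NormedSpace.induced ℝ (Shrink.{0} A) A e.toLinearMap
  exact ⟨Shrink.{0} A, n1, n2, e.symm.finiteDimensional, ⟨⟨e, fun _ => rfl⟩⟩⟩

theorem IsEpsIsometricEmbedding.comp_linearIsometry {X Y Z : Type*} [NormedAddCommGroup X]
    [NormedSpace ℝ X] [NormedAddCommGroup Y] [NormedSpace ℝ Y] [NormedAddCommGroup Z]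
    [NormedSpace ℝ Z] {ε : ℝ} {T : Y →L[ℝ] Z} (hT : IsEpsIsometricEmbedding ε T)
    (e : X →ₗᵢ[ℝ] Y) : IsEpsIsometricEmbedding ε (T ∘L e.toContinuousLinearMap) := by
  refine ⟨hT.1.comp e.injective, fun x hx => ?_⟩
  have := hT.2 (e x) ((map_ne_zero_iff e e.injective).2 hx)
  simpa using this

theorem IsEpsIsometricEmbedding.mono {X Y : Type*} [NormedAddCommGroup X]
    [NormedSpace ℝ X] [NormedAddCommGroup Y] [NormedSpace ℝ Y] {ε ε' : ℝ} {T : X →L[ℝ] Y}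
    (hT : IsEpsIsometricEmbedding ε T) (h : ε ≤ ε') : IsEpsIsometricEmbedding ε' T := by
  refine ⟨hT.1, fun x hx => ⟨lt_of_le_of_lt ?_ (hT.2 x hx).1, (hT.2 x hx).2.trans_le ?_⟩⟩ <;>
    gcongr

theorem IsEpsIsometricEmbedding.norm_apply_le {X Y : Type*} [NormedAddCommGroup X]
    [NormedSpace ℝ X] [NormedAddCommGroup Y] [NormedSpace ℝ Y] {ε : ℝ} {T : X →L[ℝ] Y}
    (hT : IsEpsIsometricEmbedding ε T) (x : X) : ‖T x‖ ≤ (1 + ε) * ‖x‖ := by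
  rcases eq_or_ne x 0 with rfl | hx
  · simp
  · exact (hT.2 x hx).2.le

theorem IsEpsIsometricEmbedding.le_norm_apply {X Y : Type*} [NormedAddCommGroup X]
    [NormedSpace ℝ X] [NormedAddCommGroup Y] [NormedSpace ℝ Y] {ε : ℝ} {T : X →L[ℝ] Y}
    (hT : IsEpsIsometricEmbedding ε T) (x : X) : (1 - ε) * ‖x‖ ≤ ‖T x‖ := by
  rcases eq_or_ne x 0 with rfl | hx
  · simp
  · exact (hT.2 x hx).1.le

/-- The extension property of a Gurarii operator, stated for isometric embeddings in place of
inclusions of subspaces and for spaces in arbitrary universes. -/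
theorem IsGurariiOperator.exists_extension {X Y : Type*} [NormedAddCommGroup X] [NormedSpace ℝ X]
    [NormedAddCommGroup Y] [NormedSpace ℝ Y] {G : X →L[ℝ] Y} (hG : IsGurariiOperator G)
    {ε : ℝ} (hε : 0 < ε) {A B A₀ B₀ : Type*}
    [NormedAddCommGroup A] [NormedSpace ℝ A] [FiniteDimensional ℝ A]
    [NormedAddCommGroup B] [NormedSpace ℝ B] [FiniteDimensional ℝ B]
    [NormedAddCommGroup A₀] [NormedSpace ℝ A₀] [NormedAddCommGroup B₀] [NormedSpace ℝ B₀]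
    (T : A →L[ℝ] B) (hT : ‖T‖ ≤ 1) (e : A₀ →ₗᵢ[ℝ] A) (f : B₀ →ₗᵢ[ℝ] B) (T₀ : A₀ → B₀)
    (hT₀ : ∀ a, T (e a) = f (T₀ a)) (i₀ : A₀ →ₗᵢ[ℝ] X) (j₀ : B₀ →ₗᵢ[ℝ] Y)
    (h : ∀ a, G (i₀ a) = j₀ (T₀ a)) :
    ∃ (i : A →L[ℝ] X) (j : B →L[ℝ] Y),
      IsEpsIsometricEmbedding ε i ∧ IsEpsIsometricEmbedding ε j ∧
      (∀ a, i (e a) = i₀ a) ∧ (∀ b, j (f b) = j₀ b) ∧ G ∘L i = j ∘L T := by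
  obtain ⟨A', _, _, _, ⟨φ⟩⟩ := exists_linearIsometryEquiv_type0 A
  obtain ⟨B', _, _, _, ⟨ψ⟩⟩ := exists_linearIsometryEquiv_type0 B
  let e' : A₀ →ₗᵢ[ℝ] A' := φ.symm.toLinearIsometry.comp e
  let f' : B₀ →ₗᵢ[ℝ] B' := ψ.symm.toLinearIsometry.comp f
  let T' : A' →L[ℝ] B' := ψ.symm.toLinearIsometry.toContinuousLinearMap ∘L T ∘L
    φ.toLinearIsometry.toContinuousLinearMap
  have hT'e : ∀ a, T' (e' a) = f' (T₀ a) := fun a => by simp [T', e', f', hT₀]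
  have hT' : ‖T'‖ ≤ 1 := by
    refine T'.opNorm_le_bound zero_le_one fun x => ?_
    simpa [T'] using T.le_of_opNorm_le hT (φ x)
  have hmem : ∀ a ∈ e'.range, T' a ∈ f'.range := by
    rintro _ ⟨a, rfl⟩
    exact ⟨T₀ a, (hT'e a).symm⟩
  obtain ⟨i, j, hi, hj, hi₀, hj₀, hij⟩ := hG.2 ε hε A' B' T' hT' e'.range f'.range hmem
    (i₀.comp e'.equivRange.symm.toLinearIsometry) (j₀.comp f'.equivRange.symm.toLinearIsometry) (by
      rintro ⟨_, a, rfl⟩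
      have h1 : e'.equivRange.symm ⟨e' a, ⟨a, rfl⟩⟩ = a := e'.equivRange.symm_apply_apply a
      have h2 : (⟨T' (e' a), hmem _ ⟨a, rfl⟩⟩ : f'.range) = f'.equivRange (T₀ a) :=
        Subtype.ext (hT'e a)
      exact (congrArg (fun z => G (i₀ z)) h1).trans ((h a).trans
        (congrArg j₀ ((congrArg f'.equivRange.symm h2).trans
          (f'.equivRange.symm_apply_apply (T₀ a))).symm)))
  refine ⟨i ∘L φ.symm.toLinearIsometry.toContinuousLinearMap,
    j ∘L ψ.symm.toLinearIsometry.toContinuousLinearMap, hi.comp_linearIsometry _,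
    hj.comp_linearIsometry _, fun a => ?_, fun b => ?_, ?_⟩
  · exact (hi₀ ⟨e' a, ⟨a, rfl⟩⟩).trans (congrArg i₀ (e'.equivRange.symm_apply_apply a))
  · exact (hj₀ ⟨f' b, ⟨b, rfl⟩⟩).trans (congrArg j₀ (f'.equivRange.symm_apply_apply b))
  · ext a
    simpa [T'] using DFunLike.congr_fun hij (φ.symm a)

/-! ### Amalgamation along an almost isometric operator -/

universe u₁ u₂ u₃ u₄

/-- The `ℓ¹`-sum of three normed spaces. -/
abbrev L1Triple (X Z V : Type*) : Type _ := WithLp 1 (X × WithLp 1 (Z × V))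

/-- The element of an `ℓ¹`-sum with the given components. -/
abbrev L1Triple.mk {X Z V : Type*} (x : X) (z : Z) (v : V) : L1Triple X Z V :=
  WithLp.toLp 1 (x, WithLp.toLp 1 (z, v))

theorem L1Triple.norm_mk {X Z V : Type*} [NormedAddCommGroup X] [NormedAddCommGroup Z]
    [NormedAddCommGroup V] (x : X) (z : Z) (v : V) :
    ‖L1Triple.mk x z v‖ = ‖x‖ + (‖z‖ + ‖v‖) := by
  simp [L1Triple.mk, WithLp.prod_norm_eq_of_L1]

/-- The amalgam `X ⊕ Z` of `X` and `Z` along an operator `g : X₀ → Z` with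
`(1 - α)‖u‖ ≤ ‖g u‖ ≤ (1 + α)‖u‖`, where `e : X₀ → X` is an isometric embedding. Its norm is
`‖(x, z)‖ = inf_u (‖x - e u‖ + ‖z + g u‖ + α ‖u‖)`, the largest one under which `X` and `Z` are
isometrically embedded and `e u`, `g u` are at distance at most `α ‖u‖`; the last conjunct is the
corresponding universal property. -/
theorem exists_amalgam {X : Type u₁} {X₀ : Type u₂} {Z : Type u₃} [NormedAddCommGroup X]
    [NormedSpace ℝ X] [FiniteDimensional ℝ X]
    [NormedAddCommGroup X₀] [NormedSpace ℝ X₀] [FiniteDimensional ℝ X₀]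
    [NormedAddCommGroup Z] [NormedSpace ℝ Z] [FiniteDimensional ℝ Z]
    (e : X₀ →ₗᵢ[ℝ] X) (g : X₀ →L[ℝ] Z) {α : ℝ} (hα : 0 < α)
    (h₁ : ∀ u, ‖u‖ ≤ ‖g u‖ + α * ‖u‖) (h₂ : ∀ u, ‖g u‖ ≤ ‖u‖ + α * ‖u‖) :
    ∃ (E : Type (max u₁ u₂ u₃)) (_ : NormedAddCommGroup E) (_ : NormedSpace ℝ E)
      (a : X →ₗᵢ[ℝ] E) (b : Z →ₗᵢ[ℝ] E),
      FiniteDimensional ℝ E ∧ (∀ u, ‖a (e u) - b (g u)‖ ≤ α * ‖u‖) ∧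
      ∀ (F : Type u₄) [NormedAddCommGroup F] [NormedSpace ℝ F] (S : X →L[ℝ] F) (R : Z →L[ℝ] F),
        ‖S‖ ≤ 1 → ‖R‖ ≤ 1 → (∀ u, ‖S (e u) - R (g u)‖ ≤ α * ‖u‖) →
        ∃ T : E →L[ℝ] F, ‖T‖ ≤ 1 ∧ (∀ x, T (a x) = S x) ∧ ∀ z, T (b z) = R z := by
  have tri_sub : ∀ (x : X) (z : Z) (v : X₀) (x' : X) (z' : Z) (v' : X₀),
      L1Triple.mk x z v - L1Triple.mk x' z' v' = L1Triple.mk (x - x') (z - z') (v - v') :=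
    fun _ _ _ _ _ _ => rfl
  have : FiniteDimensional ℝ (WithLp 1 (Z × X₀)) :=
    (WithLp.linearEquiv 1 ℝ (Z × X₀)).symm.finiteDimensional
  have : FiniteDimensional ℝ (L1Triple X Z X₀) :=
    (WithLp.linearEquiv 1 ℝ (X × WithLp 1 (Z × X₀))).symm.finiteDimensional
  -- The amalgam is the quotient of the `ℓ¹`-sum of `X`, `Z` and `X₀` by all `(e u, -g u, α u)`.
  let rel : X₀ →ₗ[ℝ] L1Triple X Z X₀ :=
    { toFun := fun u => L1Triple.mk (e u) (-g u) (α • u)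
      map_add' := fun u v => by
        rw [map_add, map_add, neg_add, smul_add]
        rfl
      map_smul' := fun c u => by
        rw [map_smul, map_smul, smul_comm α c, ← smul_neg]
        rfl }
  let N : Submodule ℝ (L1Triple X Z X₀) := LinearMap.range rel
  have : IsClosed (N : Set (L1Triple X Z X₀)) := N.closed_of_finiteDimensional
  let π : L1Triple X Z X₀ →ₗ[ℝ] L1Triple X Z X₀ ⧸ N := N.mkQ
  have π_le : ∀ m, ‖π m‖ ≤ ‖m‖ := Submodule.Quotient.norm_mk_le N
  have le_π : ∀ (m : L1Triple X Z X₀) (c : ℝ), (∀ u, c ≤ ‖m + rel u‖) → c ≤ ‖π m‖ := by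
    intro m c hc
    refine le_of_forall_pos_le_add fun t ht => ?_
    obtain ⟨m', hm', hlt⟩ := Submodule.Quotient.norm_mk_lt (π m) ht
    obtain ⟨u, hu⟩ := (Submodule.Quotient.eq N).1 hm'
    have := hc u
    rw [hu, add_sub_cancel] at this
    exact this.trans hlt.le
  let ιX : X →ₗ[ℝ] L1Triple X Z X₀ :=
    { toFun := fun x => L1Triple.mk x 0 0
      map_add' := fun x y => by
        refine Eq.trans (b := L1Triple.mk (x + y) (0 + 0) (0 + 0)) ?_ rfl
        simp only [add_zero]
      map_smul' := fun c x => by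
        refine Eq.trans (b := L1Triple.mk (c • x) (c • 0) (c • 0)) ?_ rfl
        simp only [smul_zero] }
  let ιZ : Z →ₗ[ℝ] L1Triple X Z X₀ :=
    { toFun := fun z => L1Triple.mk 0 z 0
      map_add' := fun x y => by
        refine Eq.trans (b := L1Triple.mk (0 + 0) (x + y) (0 + 0)) ?_ rfl
        simp only [add_zero]
      map_smul' := fun c x => by
        refine Eq.trans (b := L1Triple.mk (c • 0) (c • x) (c • 0)) ?_ rfl
        simp only [smul_zero] }
  have norm_smul_α : ∀ u : X₀, ‖α • u‖ = α * ‖u‖ := fun u => by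
    rw [norm_smul, Real.norm_of_nonneg hα.le]
  let a : X →ₗᵢ[ℝ] L1Triple X Z X₀ ⧸ N := ⟨π ∘ₗ ιX, fun x => by
    refine le_antisymm ((π_le _).trans_eq ?_) (le_π _ _ fun u => ?_)
    · simp [ιX, L1Triple.norm_mk]
    · have h : ιX x + rel u = L1Triple.mk (x + e u) (0 + -g u) (0 + α • u) := rfl
      rw [h, L1Triple.norm_mk, zero_add, zero_add, norm_neg, norm_smul_α]
      have := norm_sub_le (x + e u) (e u)
      rw [add_sub_cancel_right, e.norm_map] at this
      linarith [h₁ u]⟩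
  let b : Z →ₗᵢ[ℝ] L1Triple X Z X₀ ⧸ N := ⟨π ∘ₗ ιZ, fun z => by
    refine le_antisymm ((π_le _).trans_eq ?_) (le_π _ _ fun u => ?_)
    · simp [ιZ]
    · have h : ιZ z + rel u = L1Triple.mk (0 + e u) (z + -g u) (0 + α • u) := rfl
      rw [h, L1Triple.norm_mk, zero_add, zero_add, e.norm_map, norm_smul_α]
      have := norm_add_le (z + -g u) (g u)
      rw [neg_add_cancel_right] at this
      linarith [h₂ u]⟩
  refine ⟨L1Triple X Z X₀ ⧸ N, inferInstance, inferInstance, a, b, inferInstance, fun u => ?_, ?_⟩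
  · have h : a (e u) - b (g u) = π (L1Triple.mk 0 0 (-(α • u))) := by
      have h1 : a (e u) - b (g u) = π (ιX (e u) - ιZ (g u)) := (map_sub π _ _).symm
      rw [h1]
      refine (Submodule.Quotient.eq N).2 ⟨u, ?_⟩
      simp only [ιX, ιZ, rel, LinearMap.coe_mk, AddHom.coe_mk, tri_sub]
      simp
    rw [h]
    refine (π_le _).trans_eq ?_
    rw [L1Triple.norm_mk, norm_neg, norm_smul_α, norm_zero, norm_zero, zero_add, zero_add]
  · intro F _ _ S R hS hR hSR
    let L : L1Triple X Z X₀ →ₗ[ℝ] F :=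
      { toFun := fun m => S m.fst + (R m.snd.fst + α⁻¹ • (R (g m.snd.snd) - S (e m.snd.snd)))
        map_add' := fun m m' => by
          simp only [WithLp.add_fst, WithLp.add_snd, map_add, smul_sub, smul_add]
          abel
        map_smul' := fun c m => by
          simp only [WithLp.smul_fst, WithLp.smul_snd, map_smul, smul_add, smul_sub,
            RingHom.id_apply, smul_comm α⁻¹ c] }
    have hL : N ≤ LinearMap.ker L := by
      rintro _ ⟨u, rfl⟩
      have : L (rel u) = S (e u) + (R (-g u) + α⁻¹ • (R (g (α • u)) - S (e (α • u)))) := rfl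
      rw [LinearMap.mem_ker, this]
      simp only [map_neg, map_smul, ← smul_sub, inv_smul_smul₀ hα.ne']
      abel
    have hLn : ∀ m, ‖L m‖ ≤ ‖m‖ := by
      intro m
      have h3 : ‖α⁻¹ • (R (g m.snd.snd) - S (e m.snd.snd))‖ ≤ ‖m.snd.snd‖ := by
        rw [norm_smul, Real.norm_of_nonneg (inv_nonneg.2 hα.le), norm_sub_rev,
          inv_mul_le_iff₀ hα]
        exact hSR _
      calc ‖L m‖ ≤ ‖S m.fst‖ + (‖R m.snd.fst‖ +
            ‖α⁻¹ • (R (g m.snd.snd) - S (e m.snd.snd))‖) :=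
            (norm_add_le _ _).trans (by gcongr; exact norm_add_le _ _)
        _ ≤ ‖m.fst‖ + (‖m.snd.fst‖ + ‖m.snd.snd‖) := by
            have h1 := S.le_of_opNorm_le hS m.fst
            have h2 := R.le_of_opNorm_le hR m.snd.fst
            rw [one_mul] at h1 h2
            gcongr
        _ = ‖m‖ := (L1Triple.norm_mk _ _ _).symm
    refine ⟨(N.liftQ L hL).mkContinuous 1 fun q => ?_,
      LinearMap.mkContinuous_norm_le _ zero_le_one _, fun x => ?_, fun z => ?_⟩
    · rw [one_mul]
      refine le_of_forall_pos_le_add fun t ht => ?_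
      obtain ⟨m, rfl, hm⟩ := Submodule.Quotient.norm_mk_lt q ht
      exact (hLn m).trans hm.le
    · have : L (ιX x) = S x + (R 0 + α⁻¹ • (R (g 0) - S (e 0))) := rfl
      refine Eq.trans (b := L (ιX x)) rfl ?_
      simp [this]
    · have : L (ιZ z) = S 0 + (R z + α⁻¹ • (R (g 0) - S (e 0))) := rfl
      refine Eq.trans (b := L (ιZ z)) rfl ?_
      simp [this]

/-! ### Estimates for `δ(ε, n, m, t)` -/

theorem le_delta {ε n m t n' m' t' : ℝ} (hε : 0 < ε) (hε1 : ε ≤ 1) (hn' : 0 ≤ n') (hn : n' ≤ n)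
    (hm' : 0 ≤ m') (hm : m' ≤ m) (ht' : 0 ≤ t') (ht : t' ≤ t) :
    ε / (1 + 2 * ((n + 1) * max 1 (t * √(n * m)))) ≤ delta ε n' m' t' := by
  refine (isGreatest_delta m' t' hε.le hn').2 ?_
  have ht0 : 0 ≤ t := ht'.trans ht
  have hn0 : 0 ≤ n := hn'.trans hn
  have hM : max 1 (t' * √(n' * m')) ≤ max 1 (t * √(n * m)) := by
    gcongr
  have hM1 : (1 : ℝ) ≤ max 1 (t' * √(n' * m')) := le_max_left _ _
  set M := max 1 (t * √(n * m))
  set M' := max 1 (t' * √(n' * m'))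
  have hM0 : 0 < M := by linarith
  have hK : (n' + 1) * M' ≤ (n + 1) * M := by gcongr
  have hK0 : 0 ≤ (n' + 1) * M' := by positivity
  have hK1 : 0 ≤ (n + 1) * M := hK0.trans hK
  set K := (n + 1) * M
  have hd1 : ε / (1 + 2 * K) ≤ 1 := by
    rw [div_le_one (by positivity)]
    linarith
  set d := ε / (1 + 2 * K) with hd
  have hd0 : 0 < d := by positivity
  calc d * (1 + (1 + d) * (n' + 1) * M') = d * (1 + (1 + d) * ((n' + 1) * M')) := by ring
    _ ≤ d * (1 + (1 + 1) * K) := by gcongr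
    _ = ε := by
      rw [hd]
      field_simp
      ring

theorem delta_pos {ε n m t : ℝ} (hε : 0 < ε) (hε1 : ε ≤ 1) (hn : 0 ≤ n) (hm : 0 ≤ m)
    (ht : 0 ≤ t) : 0 < delta ε n m t :=
  lt_of_lt_of_le (by positivity) (le_delta hε hε1 hn le_rfl hm le_rfl ht le_rfl)

theorem two_mul_delta_lt {ε n m t : ℝ} (hε : 0 < ε) (hε1 : ε ≤ 1) (hn : 0 ≤ n) (hm : 0 ≤ m)
    (ht : 0 ≤ t) : 2 * delta ε n m t < ε := by
  have h : delta ε n m t * (1 + (1 + delta ε n m t) * (n + 1) * max 1 (t * √(n * m))) ≤ ε :=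
    (isGreatest_delta m t hε.le hn).1
  have hd := delta_pos hε hε1 hn hm ht (t := t)
  have hM : (1 : ℝ) ≤ max 1 (t * √(n * m)) := le_max_left _ _
  set d := delta ε n m t
  set M := max 1 (t * √(n * m))
  have h1 : 1 ≤ (n + 1) * M := by nlinarith
  have h2 : 1 < (1 + d) * (n + 1) * M := by nlinarith
  nlinarith

/-! ### Gurarii operators satisfy (GC) -/

theorem IsGurariiOperator.conditionGC {𝔾 : Type u₃} [NormedAddCommGroup 𝔾] [NormedSpace ℝ 𝔾]
    {G : 𝔾 →L[ℝ] 𝔾} (hG : IsGurariiOperator G) (D : Set 𝔾) : ConditionGC D G := by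
  intro t ht
  have hε0 : (0 : ℝ) < t.ε := by exact_mod_cast t.ε_pos
  have hε1 : (t.ε : ℝ) ≤ 1 := by exact_mod_cast t.ε_le_one
  have hd0 := delta_pos (n := Module.finrank ℝ t.X₀) (m := Module.finrank ℝ t.Y₀)
    (t := (opennessNorm t.T₀).toReal) hε0 hε1 (by positivity) (by positivity) (by positivity)
  have hd2 := two_mul_delta_lt (n := Module.finrank ℝ t.X₀) (m := Module.finrank ℝ t.Y₀)
    (t := (opennessNorm t.T₀).toReal) hε0 hε1 (by positivity) (by positivity) (by positivity)
  have hi₀ := t.i₀_isometric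
  have hj₀ := t.j₀_isometric
  set d := delta t.ε (Module.finrank ℝ t.X₀) (Module.finrank ℝ t.Y₀) (opennessNorm t.T₀).toReal
  let Z : Submodule ℝ 𝔾 := LinearMap.range (t.i₀ : t.X₀ →ₗ[ℝ] 𝔾)
  let W : Submodule ℝ 𝔾 := LinearMap.range (t.j₀ : t.Y₀ →ₗ[ℝ] 𝔾) ⊔ Z.map (G : 𝔾 →ₗ[ℝ] 𝔾)
  let g : t.X₀ →L[ℝ] Z := t.i₀.codRestrict Z fun x => ⟨x, rfl⟩
  let h : t.Y₀ →L[ℝ] W := t.j₀.codRestrict W fun y => Submodule.mem_sup_left ⟨y, rfl⟩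
  let GZ : Z →L[ℝ] W := (G ∘L Z.subtypeL).codRestrict W fun z =>
    Submodule.mem_sup_right ⟨z, z.2, rfl⟩
  have hGZ : ‖GZ‖ ≤ 1 := by
    refine GZ.opNorm_le_bound zero_le_one fun z => ?_
    exact G.le_of_opNorm_le hG.1 z
  obtain ⟨E, _, _, a, b, _, hab, hE⟩ := exists_amalgam t.X₀.subtypeₗᵢ g (α := 2 * d) (by positivity)
    (fun u => by
      have h1 : (1 - d) * ‖u‖ ≤ ‖g u‖ := hi₀.le_norm_apply u
      nlinarith [norm_nonneg u])
    (fun u => by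
      have h1 : ‖g u‖ ≤ (1 + d) * ‖u‖ := hi₀.norm_apply_le u
      nlinarith [norm_nonneg u])
  obtain ⟨F, _, _, a', b', _, hab', -⟩ := exists_amalgam.{0, 0, u₃, 0} t.Y₀.subtypeₗᵢ h (α := d) hd0
    (fun u => by
      have h1 : (1 - d) * ‖u‖ ≤ ‖h u‖ := hj₀.le_norm_apply u
      linarith)
    (fun u => by
      have h1 : ‖h u‖ ≤ (1 + d) * ‖u‖ := hj₀.norm_apply_le u
      linarith)
  obtain ⟨T, hT, hTa, hTb⟩ := hE F (a'.toContinuousLinearMap ∘L t.T)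
    (b'.toContinuousLinearMap ∘L GZ)
    (ContinuousLinearMap.opNorm_le_bound _ zero_le_one fun x => by
      simpa using t.T.le_of_opNorm_le t.T_nonexpansive x)
    (ContinuousLinearMap.opNorm_le_bound _ zero_le_one fun x => by
      simpa using GZ.le_of_opNorm_le hGZ x)
    (fun u => by
      have h1 : ‖a' (t.T₀ u) - b' (h (t.T₀ u))‖ ≤ d * ‖u‖ := by
        refine (hab' (t.T₀ u)).trans ?_
        gcongr
        have : ‖t.T₀ u‖ = ‖t.T u‖ := congrArg norm (t.T₀_apply u)
        rw [this]
        simpa using t.T.le_of_opNorm_le t.T_nonexpansive u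
      have h2 : ‖b' (GZ (g u)) - b' (h (t.T₀ u))‖ ≤ d * ‖u‖ := by
        rw [← map_sub, b'.norm_map]
        exact (G ∘L t.i₀ - t.j₀ ∘L t.T₀).le_of_opNorm_le ht.le u
      calc ‖a' (t.T u) - b' (GZ (g u))‖
          = ‖(a' (t.T₀ u) - b' (h (t.T₀ u))) - (b' (GZ (g u)) - b' (h (t.T₀ u)))‖ := by
            rw [sub_sub_sub_cancel_right, t.T₀_apply]
        _ ≤ 2 * d * ‖u‖ := by
            refine (norm_sub_le _ _).trans ?_
            linarith)
  set ε' := (t.ε : ℝ) - 2 * d with hε'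
  have hε'0 : 0 < ε' := by linarith
  obtain ⟨i, j, hi, hj, hib, hjb, hij⟩ := hG.exists_extension hε'0 T hT b b' GZ (fun z => hTb z)
    Z.subtypeₗᵢ W.subtypeₗᵢ (fun z => rfl)
  have hlt : (1 + ε') * (2 * d) < t.ε := by nlinarith
  refine ⟨i ∘L a.toContinuousLinearMap, j ∘L a'.toContinuousLinearMap,
    (hi.comp_linearIsometry a).mono (by linarith), (hj.comp_linearIsometry a').mono (by linarith),
    lt_of_le_of_lt (ContinuousLinearMap.opNorm_le_bound _ (by positivity) fun u => ?_) hlt,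
    lt_of_le_of_lt (ContinuousLinearMap.opNorm_le_bound _ (by positivity) fun u => ?_) hlt, ?_⟩
  · have h1 : (i ∘L a.toContinuousLinearMap ∘L t.X₀.subtypeL - t.i₀) u =
        i (a (t.X₀.subtypeₗᵢ u) - b (g u)) := by
      rw [map_sub, hib]
      rfl
    refine (congrArg norm h1).trans_le ((hi.norm_apply_le _).trans ?_)
    rw [mul_assoc]
    gcongr
    exact hab u
  · have h1 : (j ∘L a'.toContinuousLinearMap ∘L t.Y₀.subtypeL - t.j₀) u =
        j (a' (t.Y₀.subtypeₗᵢ u) - b' (h u)) := by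
      rw [map_sub, hjb]
      rfl
    refine (congrArg norm h1).trans_le ((hj.norm_apply_le _).trans ?_)
    rw [mul_assoc]
    gcongr
    refine (hab' u).trans ?_
    gcongr
    linarith
  · have h1 : G ∘L (i ∘L a.toContinuousLinearMap) - (j ∘L a'.toContinuousLinearMap) ∘L t.T = 0 := by
      ext x
      have := DFunLike.congr_fun hij (a x)
      simp only [ContinuousLinearMap.comp_apply, hTa] at this
      simp [this]
    rw [h1, norm_zero]
    exact hε0

/-! ### Approximation by rational norms -/

open Topology in
/-- Each closed ball of radius less than one lies in the convex hull of finitely many rational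
points of the unit ball: a compactness argument over small rational cubes. -/
theorem exists_rational_convexHull {n : ℕ} {A : Type*} [NormedAddCommGroup A] [NormedSpace ℝ A]
    (L : (Fin n → ℝ) ≃L[ℝ] A) {r : ℝ} (hr : r < 1) :
    ∃ F : Finset (Fin n → ℚ), (∀ q ∈ F, ‖L fun i => (q i : ℝ)‖ ≤ 1) ∧
      {x | ‖L x‖ ≤ r} ⊆ convexHull ℝ
        ((fun (q : Fin n → ℚ) (i : Fin n) => (q i : ℝ)) '' (F : Set (Fin n → ℚ))) := by
  classical
  have : FiniteDimensional ℝ A := L.toLinearEquiv.finiteDimensional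
  have : ProperSpace A := FiniteDimensional.proper ℝ A
  have hK : IsCompact {x | ‖L x‖ ≤ r} := by
    have h := (isCompact_closedBall (0 : A) r).image L.symm.continuous
    convert h using 1
    rw [L.symm.image_eq_preimage_symm]
    ext x
    simp
  refine hK.induction_on (p := fun s => ∃ F : Finset (Fin n → ℚ),
    (∀ q ∈ F, ‖L fun i => (q i : ℝ)‖ ≤ 1) ∧ s ⊆ convexHull ℝ
        ((fun (q : Fin n → ℚ) (i : Fin n) => (q i : ℝ)) '' (F : Set (Fin n → ℚ))))
    ⟨∅, by simp, by simp⟩ (fun s t hst ⟨F, h1, h2⟩ => ⟨F, h1, hst.trans h2⟩) ?_ ?_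
  · rintro s t ⟨F, hF, hs⟩ ⟨F', hF', ht⟩
    refine ⟨F ∪ F', fun q hq => (Finset.mem_union.1 hq).elim (hF q) (hF' q), ?_⟩
    rw [Finset.coe_union, Set.image_union]
    exact Set.union_subset (hs.trans (convexHull_mono Set.subset_union_left))
      (ht.trans (convexHull_mono Set.subset_union_right))
  · intro x hx
    have hU : {y | ‖L y‖ < 1} ∈ 𝓝 x :=
      (isOpen_lt L.continuous.norm continuous_const).mem_nhds (lt_of_le_of_lt hx hr)
    obtain ⟨ρ, hρ, hball⟩ := Metric.mem_nhds_iff.1 hU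
    choose a ha1 ha2 using fun i => exists_rat_btwn (sub_lt_self (x i) hρ)
    choose b hb1 hb2 using fun i => exists_rat_btwn (lt_add_of_pos_right (x i) hρ)
    have hab : ∀ i, (a i : ℝ) ≤ b i := fun i => ((ha2 i).trans (hb1 i)).le
    let F : Finset (Fin n → ℚ) := Fintype.piFinset fun i => {a i, b i}
    have himg : (fun (q : Fin n → ℚ) (i : Fin n) => (q i : ℝ)) '' (F : Set (Fin n → ℚ)) =
        Set.univ.pi fun i => {(a i : ℝ), (b i : ℝ)} := by
      ext y
      simp only [Set.mem_image, SetLike.mem_coe, Set.mem_pi, Set.mem_univ, true_imp_iff,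
        Set.mem_insert_iff, Set.mem_singleton_iff, F, Fintype.mem_piFinset,
        Finset.mem_insert, Finset.mem_singleton]
      constructor
      · rintro ⟨q, hq, rfl⟩ i
        exact (hq i).imp (congrArg Rat.cast) (congrArg Rat.cast)
      · intro hy
        refine ⟨fun i => if y i = a i then a i else b i, fun i => ?_, funext fun i => ?_⟩
        · dsimp only
          split_ifs <;> simp
        · dsimp only
          split_ifs with h
          · exact h.symm
          · exact ((hy i).resolve_left h).symm
    have hhull : convexHull ℝ ((fun (q : Fin n → ℚ) (i : Fin n) => (q i : ℝ)) ''
        (F : Set (Fin n → ℚ))) = Set.univ.pi fun i => Set.Icc (a i : ℝ) (b i) := by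
      rw [himg, convexHull_pi]
      congr 1
      ext1 i
      rw [convexHull_pair, segment_eq_Icc (hab i)]
    refine ⟨Set.univ.pi fun i => Set.Icc (a i : ℝ) (b i), mem_nhdsWithin_of_mem_nhds
      (set_pi_mem_nhds Set.finite_univ fun i _ => Icc_mem_nhds (ha2 i) (hb1 i)), F,
      fun q hq => ?_, hhull.ge⟩
    have hq' : (fun i => (q i : ℝ)) ∈ Set.univ.pi fun i => Set.Icc (a i : ℝ) (b i) :=
      hhull ▸ subset_convexHull ℝ _ ⟨q, hq, rfl⟩
    have hq2 : (fun i => (q i : ℝ)) ∈ Metric.ball x ρ := by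
      rw [Metric.mem_ball, dist_pi_lt_iff hρ]
      intro i
      rw [Real.dist_eq, abs_lt]
      have := hq' i trivial
      constructor <;> linarith [ha1 i, hb2 i, this.1, this.2]
    exact (hball hq2).le

/-- Every norm on `ℝⁿ` is approximated from above by rational norms, and prescribed rational
points of its unit ball can be kept in the rational unit ball. -/
theorem exists_rationalNorm_approx {n : ℕ} {A : Type*} [NormedAddCommGroup A] [NormedSpace ℝ A]
    (L : (Fin n → ℝ) ≃L[ℝ] A) {η : ℝ} (hη : 0 < η) (E : Finset (Fin n → ℚ))
    (hE : ∀ q ∈ E, ‖L fun i => (q i : ℝ)‖ ≤ 1) :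
    ∃ p : RationalNorm n, (∀ x, ‖L x‖ ≤ p.toSeminorm x) ∧
      (∀ x, p.toSeminorm x ≤ (1 + η) * ‖L x‖) ∧
      ∀ q ∈ E, p.toSeminorm (fun i => (q i : ℝ)) ≤ 1 := by
  classical
  obtain ⟨F₁, hF₁, hball⟩ := exists_rational_convexHull L (r := (1 + η)⁻¹)
    (inv_lt_one_of_one_lt₀ (by linarith))
  let F₂ : Finset (Fin n → ℚ) := F₁ ∪ E
  let F : Finset (Fin n → ℚ) := F₂ ∪ F₂.image Neg.neg
  let ι : (Fin n → ℚ) → Fin n → ℝ := fun q i => (q i : ℝ)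
  have hι : ∀ q, ι (-q) = -ι q := fun q => funext fun i => by simp [ι]
  let s : Set (Fin n → ℝ) := convexHull ℝ (ι '' (F : Set (Fin n → ℚ)))
  have hFn : ∀ q ∈ F, ‖L (ι q)‖ ≤ 1 := by
    have h2 : ∀ q ∈ F₂, ‖L (ι q)‖ ≤ 1 := fun q hq => (Finset.mem_union.1 hq).elim (hF₁ q) (hE q)
    intro q hq
    rcases Finset.mem_union.1 hq with hq | hq
    · exact h2 q hq
    · obtain ⟨q', hq', rfl⟩ := Finset.mem_image.1 hq
      rw [hι, map_neg, norm_neg]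
      exact h2 q' hq'
  have hs_conv : Convex ℝ s := convex_convexHull ℝ _
  have hs_norm : ∀ x ∈ s, ‖L x‖ ≤ 1 := by
    have hc : Convex ℝ {x | ‖L x‖ ≤ 1} := by
      have h : {x | ‖L x‖ ≤ 1} =
          (L : (Fin n → ℝ) →ₗ[ℝ] A) ⁻¹' Metric.closedBall (0 : A) 1 := by
        ext x
        simp
      rw [h]
      exact (convex_closedBall (0 : A) 1).linear_preimage _
    refine convexHull_min ?_ hc
    rintro _ ⟨q, hq, rfl⟩
    exact hFn q hq
  have hs_ball : {x | ‖L x‖ ≤ (1 + η)⁻¹} ⊆ s := hball.trans (convexHull_mono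
    (Set.image_mono (by simp only [F, F₂, Finset.coe_union]; exact
      Set.subset_union_left.trans Set.subset_union_left)))
  have hs_nhds : s ∈ nhds (0 : Fin n → ℝ) := by
    refine Filter.mem_of_superset ((isOpen_lt L.continuous.norm continuous_const).mem_nhds
      (show ‖L 0‖ < (1 + η)⁻¹ by simpa using by positivity)) fun x hx =>
        hs_ball (show ‖L x‖ ≤ _ from le_of_lt hx)
  have hs_neg : ∀ ⦃x⦄, x ∈ s → -x ∈ s := by
    intro x hx
    have h1 : -x ∈ -s := by simpa using hx
    rw [← convexHull_neg] at h1
    refine convexHull_mono ?_ h1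
    rintro y hy
    obtain ⟨q, hq, hqy⟩ := hy
    refine ⟨-q, ?_, by rw [hι, hqy, neg_neg]⟩
    simp only [F, Finset.mem_coe, Finset.mem_union, Finset.mem_image] at hq ⊢
    rcases hq with hq | ⟨q', hq', rfl⟩
    · exact Or.inr ⟨q, hq, rfl⟩
    · rw [neg_neg]
      exact Or.inl hq'
  have hs_closed : IsClosed s :=
    ((F.finite_toSet.image ι).isCompact_convexHull ℝ).isClosed
  let P : Seminorm ℝ (Fin n → ℝ) := gaugeSeminorm ((balanced_iff_neg_mem hs_conv).2 hs_neg)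
    hs_conv (absorbent_nhds_zero hs_nhds)
  have hP : ∀ x, P x ≤ 1 ↔ x ∈ s := fun x => by
    rw [← hs_closed.closure_eq]
    exact (gauge_le_one_iff_mem_closure hs_conv hs_nhds)
  have hLP : ∀ x, ‖L x‖ ≤ P x := seminorm_le_of_unitBall_subset (p := P)
    (q := (normSeminorm ℝ A).comp (L : (Fin n → ℝ) →ₗ[ℝ] A)) fun x hx => hs_norm x ((hP x).1 hx)
  refine ⟨{ P with
      eq_zero_of_map_eq_zero' := fun x hx => L.injective ?_
      rational' := ⟨F, Set.ext hP⟩ }, hLP, fun x => ?_, fun q hq => ?_⟩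
  · rw [map_zero]
    exact norm_le_zero_iff.1 ((hLP x).trans_eq hx)
  · have h := seminorm_le_of_unitBall_subset (q := P) (p := (normSeminorm ℝ A).comp
      ((1 + η) • (L : (Fin n → ℝ) →ₗ[ℝ] A))) (fun x hx => (hP x).2 (hs_ball ?_)) x
    · refine h.trans_eq ?_
      simp [norm_smul, abs_of_pos (by linarith : 0 < 1 + η)]
    · simp only [Seminorm.comp_apply, LinearMap.smul_apply, coe_normSeminorm, norm_smul,
        Real.norm_of_nonneg (by linarith : 0 ≤ 1 + η)] at hx
      rw [Set.mem_ofPred_eq, ← one_div, le_div_iff₀' (by linarith)]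
      exact hx
  · refine (hP _).2 (subset_convexHull ℝ _ ⟨q, ?_, rfl⟩)
    simp [F, F₂, hq]

/-! ### Bases adapted to two subspaces -/

theorem exists_adapted_basis {V : Type*} [AddCommGroup V] [Module ℝ V] [FiniteDimensional ℝ V]
    (K A₀ : Submodule ℝ V) :
    ∃ (k l : ℕ) (b : Module.Basis (Fin (k + l)) ℝ V) (S : Set (Fin (k + l))),
      K = Submodule.span ℝ (b '' {i | (i : ℕ) < k}) ∧ A₀ = Submodule.span ℝ (b '' S) := by
  classical
  have span_eq : ∀ {s : Set V} {W : Submodule ℝ V}, s ⊆ W → (W : Set V) ⊆ Submodule.span ℝ s →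
      Submodule.span ℝ s = W := fun h1 h2 => le_antisymm (Submodule.span_le.2 h1) h2
  obtain ⟨s₀, hs₀, -, hsp₀, hli₀⟩ := exists_linearIndepOn_id_extension
    (linearIndepOn_empty ℝ (id : V → V)) (Set.empty_subset ((K ⊓ A₀ : Submodule ℝ V) : Set V))
  obtain ⟨s₁, hs₁, h01, hsp₁, hli₁⟩ := exists_linearIndepOn_id_extension hli₀
    (hs₀.trans (SetLike.coe_subset_coe.2 (inf_le_left : K ⊓ A₀ ≤ K)))
  obtain ⟨s₂, hs₂, h02, hsp₂, hli₂⟩ := exists_linearIndepOn_id_extension hli₀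
    (hs₀.trans (SetLike.coe_subset_coe.2 (inf_le_right : K ⊓ A₀ ≤ A₀)))
  have e₀ := span_eq hs₀ hsp₀
  have e₁ := span_eq hs₁ hsp₁
  have e₂ := span_eq hs₂ hsp₂
  have hsd : Disjoint (Submodule.span ℝ s₁) (Submodule.span ℝ (s₂ \ s₀)) := by
    have h1 : LinearIndepOn ℝ id (s₀ ∪ s₂ \ s₀) := by rwa [Set.union_sdiff_cancel h02]
    have h2 := ((linearIndepOn_id_union_iff Set.disjoint_sdiff_right).1 h1).2.2
    rw [Submodule.disjoint_def] at h2 ⊢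
    intro x hx hx'
    refine h2 x ?_ hx'
    rw [e₀]
    exact ⟨e₁ ▸ hx, e₂ ▸ Submodule.span_mono Set.sdiff_subset hx'⟩
  have hli : LinearIndepOn ℝ id (s₁ ∪ s₂ \ s₀) :=
    hli₁.id_union (hli₂.mono Set.sdiff_subset) hsd
  obtain ⟨s₃, -, h3, hsp₃, hli₃⟩ := exists_linearIndepOn_id_extension hli (Set.subset_univ _)
  have h13 : s₁ ⊆ s₃ := Set.subset_union_left.trans h3
  have h23 : s₂ ⊆ s₃ := fun x hx => by
    by_cases hx0 : x ∈ s₀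
    · exact h13 (h01 hx0)
    · exact h3 (Or.inr ⟨hx, hx0⟩)
  let B : Module.Basis s₃ ℝ V := Module.Basis.mk (v := fun x : s₃ => (x : V)) hli₃
    (by rw [Subtype.range_coe]; exact fun x _ => hsp₃ trivial)
  have hB : ∀ x, B x = x := fun x => Module.Basis.mk_apply _ _ x
  have : Finite s₃ := LinearIndependent.finite (R := ℝ) hli₃
  have : Fintype s₃ := Fintype.ofFinite _
  let φ : s₃ ≃ Fin (Fintype.card {x : s₃ // (x : V) ∈ s₁} +
      Fintype.card {x : s₃ // ¬ (x : V) ∈ s₁}) :=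
    (Equiv.sumCompl fun x : s₃ => (x : V) ∈ s₁).symm.trans
      ((Equiv.sumCongr (Fintype.equivFin _) (Fintype.equivFin _)).trans finSumFinEquiv)
  have hφ : ∀ x : s₃, (φ x : ℕ) < Fintype.card {x : s₃ // (x : V) ∈ s₁} ↔ (x : V) ∈ s₁ := by
    intro x
    by_cases hx : (x : V) ∈ s₁
    · simp [φ, Equiv.sumCompl_symm_apply_of_pos, hx]
    · simp [φ, Equiv.sumCompl_symm_apply_of_neg, hx]
  have himg : ∀ (s : Set V) (S : Set _), s ⊆ s₃ → (∀ x : s₃, φ x ∈ S ↔ (x : V) ∈ s) →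
      (B.reindex φ) '' S = s := by
    intro s S hs h
    ext v
    constructor
    · rintro ⟨i, hi, rfl⟩
      rw [Module.Basis.reindex_apply, hB, ← h]
      simpa using hi
    · intro hv
      exact ⟨φ ⟨v, hs hv⟩, (h ⟨v, hs hv⟩).2 hv, by simp [hB]⟩
  refine ⟨_, _, B.reindex φ, φ '' {x | (x : V) ∈ s₂}, ?_, ?_⟩
  · rw [himg s₁ _ h13 hφ, e₁]
  · rw [himg s₂ _ h23 (by simp), e₂]

/-! ### Coordinates in which an operator is standard -/

/-- The coordinate shift `ℝᵏ⁺ˡ → ℝˡ` that forgets the first `k` coordinates. -/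
def shift (k l : ℕ) : (Fin (k + l) → ℝ) →ₗ[ℝ] (Fin l → ℝ) where
  toFun x i := x ⟨i + k, by omega⟩
  map_add' _ _ := rfl
  map_smul' _ _ := rfl

theorem shift_apply {k l : ℕ} (x : Fin (k + l) → ℝ) (i : Fin l) :
    shift k l x i = x ⟨i + k, by omega⟩ := rfl

theorem shift_surjective (k l : ℕ) : Function.Surjective (shift k l) := fun y =>
  ⟨fun i => if h : k ≤ i then y ⟨i - k, by omega⟩ else 0, funext fun i => by
    simp [shift_apply]⟩

theorem shift_eq_zero_iff {k l : ℕ} {x : Fin (k + l) → ℝ} :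
    shift k l x = 0 ↔ ∀ i : Fin (k + l), k ≤ i → x i = 0 := by
  constructor
  · intro h i hi
    have := congrFun h ⟨i - k, by omega⟩
    simpa [shift_apply, Nat.sub_add_cancel hi] using this
  · intro h
    funext i
    exact h _ (by simp)

/-- There are coordinates on the domain and on the range of a linear map in which it is a shift and
a given subspace of the domain is standard. -/
theorem exists_adapted_coordinates {V F : Type*} [AddCommGroup V] [Module ℝ V]
    [FiniteDimensional ℝ V] [AddCommGroup F] [Module ℝ F] (f : V →ₗ[ℝ] F) (A₀ : Submodule ℝ V) :
    ∃ (k l : ℕ) (L : (Fin (k + l) → ℝ) ≃ₗ[ℝ] V) (M : (Fin l → ℝ) ≃ₗ[ℝ] LinearMap.range f)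
      (S : Set (Fin (k + l))), (∀ x, (M (shift k l x) : F) = f (L x)) ∧
      A₀.comap L.toLinearMap = Submodule.span ℝ ((fun i => Pi.single i 1) '' S) := by
  obtain ⟨k, l, b, S, hK, hA₀⟩ := exists_adapted_basis (LinearMap.ker f) A₀
  let L := b.equivFun.symm
  have hLs : ∀ s : Set (Fin (k + l)), (Submodule.span ℝ (b '' s)).comap L.toLinearMap =
      Submodule.span ℝ ((fun i => Pi.single i 1) '' s) := by
    intro s
    have h1 : Submodule.span ℝ (b '' s) = (Submodule.span ℝ
        ((fun i => (Pi.single i 1 : Fin (k + l) → ℝ)) '' s)).map L.toLinearMap := by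
      rw [Submodule.map_span, ← Set.image_comp]
      congr 2
      funext i
      simp [L]
    rw [h1, Submodule.comap_map_eq_of_injective L.injective]
  let g : (Fin (k + l) → ℝ) →ₗ[ℝ] LinearMap.range f := f.rangeRestrict ∘ₗ L.toLinearMap
  have hg : Function.Surjective g := f.surjective_rangeRestrict.comp L.surjective
  have hker : LinearMap.ker (shift k l) = LinearMap.ker g := by
    ext x
    have h1 : x ∈ LinearMap.ker g ↔ L x ∈ LinearMap.ker f := by
      rw [LinearMap.mem_ker, LinearMap.mem_ker]
      exact Subtype.ext_iff
    have h2 : ∀ i, b.repr (L x) i = x i := fun i => congrFun (b.equivFun.apply_symm_apply x) i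
    rw [h1, hK, b.mem_span_image, LinearMap.mem_ker, shift_eq_zero_iff]
    constructor
    · intro h i hi
      by_contra hik
      exact Finsupp.mem_support_iff.1 hi ((h2 i).trans (h i (not_lt.1 hik)))
    · intro h i hi
      by_contra h0
      exact absurd (h (Finsupp.mem_support_iff.2 fun h3 => h0 ((h2 i).symm.trans h3)))
        (not_lt.2 hi)
  let M : (Fin l → ℝ) ≃ₗ[ℝ] LinearMap.range f :=
    ((shift k l).quotKerEquivOfSurjective (shift_surjective k l)).symm.trans
      ((Submodule.quotEquivOfEq _ _ hker).trans (g.quotKerEquivOfSurjective hg))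
  refine ⟨k, l, L, M, S, fun x => ?_, by rw [hA₀, hLs]⟩
  have h1 : ((shift k l).quotKerEquivOfSurjective (shift_surjective k l)).symm (shift k l x) =
      Submodule.Quotient.mk x := by
    rw [LinearEquiv.symm_apply_eq]
    rfl
  have h2 : M (shift k l x) = g x := by
    simp only [M, LinearEquiv.trans_apply, h1]
    rfl
  rw [h2]
  rfl

/-- An operator on a space with given coordinates can be moved slightly so that it maps the
coordinate vectors into a dense set. -/
theorem exists_perturbation_into_dense {n : ℕ} {A F : Type*} [NormedAddCommGroup A]
    [NormedSpace ℝ A] [NormedAddCommGroup F] [NormedSpace ℝ F] (L : (Fin n → ℝ) ≃L[ℝ] A)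
    (φ : A →L[ℝ] F) {D : Set F} (hD : Dense D) {η : ℝ} (hη : 0 < η) :
    ∃ ψ : A →L[ℝ] F, (∀ i, ψ (L (Pi.single i 1)) ∈ D) ∧ ∀ a, ‖ψ a - φ a‖ ≤ η * ‖a‖ := by
  have hL : ∃ C > 0, ∀ a i, ‖L.symm a i‖ ≤ C * ‖a‖ :=
    ⟨‖(L.symm : A →L[ℝ] Fin n → ℝ)‖ + 1, by positivity, fun a i =>
      (norm_le_pi_norm _ i).trans (((L.symm : A →L[ℝ] Fin n → ℝ).le_opNorm a).trans
        (by gcongr; linarith))⟩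
  obtain ⟨C, hC, hL⟩ := hL
  have hθ : 0 < η / ((n + 1) * C) := by positivity
  choose w hwD hw using fun i => hD.exists_dist_lt (φ (L (Pi.single i 1))) hθ
  let ψ : (Fin n → ℝ) →L[ℝ] F := ∑ i, (ContinuousLinearMap.proj i).smulRight (w i)
  have hψ : ∀ x, ψ x = ∑ i, x i • w i := fun x => by simp [ψ]
  refine ⟨ψ ∘L (L.symm : A →L[ℝ] Fin n → ℝ), fun i => ?_, fun a => ?_⟩
  · have : ψ (Pi.single i 1) = w i := by
      rw [hψ, Finset.sum_eq_single i] <;> simp +contextual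
    simpa [this] using hwD i
  · have h1 : φ a = ∑ i, L.symm a i • φ (L (Pi.single i 1)) := by
      conv_lhs => rw [← L.apply_symm_apply a, ← Finset.univ_sum_single (L.symm a)]
      rw [map_sum, map_sum]
      refine Finset.sum_congr rfl fun i _ => ?_
      rw [← map_smul, ← map_smul, ← Pi.single_smul, smul_eq_mul, mul_one]
    have h2 : (ψ ∘L (L.symm : A →L[ℝ] Fin n → ℝ)) a - φ a =
        ∑ i, L.symm a i • (w i - φ (L (Pi.single i 1))) := by
      rw [h1]
      simp only [smul_sub, Finset.sum_sub_distrib]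
      congr 1
      exact hψ _
    rw [h2]
    calc ‖∑ i, L.symm a i • (w i - φ (L (Pi.single i 1)))‖
        ≤ ∑ _i : Fin n, (C * ‖a‖) * (η / ((n + 1) * C)) := by
          refine norm_sum_le_of_le _ fun i _ => ?_
          rw [norm_smul]
          have := (hw i).le
          rw [dist_comm, dist_eq_norm] at this
          gcongr
          exact hL a i
      _ = (n / (n + 1)) * (η * ‖a‖) := by
          rw [Finset.sum_const, Finset.card_univ, Fintype.card_fin, nsmul_eq_mul]
          field_simp
      _ ≤ 1 * (η * ‖a‖) := by
          gcongr
          rw [div_le_one (by positivity)]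
          linarith
      _ = η * ‖a‖ := one_mul _

/-- The open mapping theorem for the corestriction of an operator to its range, which is complete
because it has finite dimension. -/
theorem exists_preimage_norm_le_of_finiteDimensional {A F : Type*} [NormedAddCommGroup A]
    [NormedSpace ℝ A] [FiniteDimensional ℝ A] [NormedAddCommGroup F] [NormedSpace ℝ F]
    (S : A →L[ℝ] F) : ∃ C > 0, ∀ a, ∃ a', S a' = S a ∧ ‖a'‖ ≤ C * ‖S a‖ := by
  have : CompleteSpace A := FiniteDimensional.complete ℝ A
  have : CompleteSpace (LinearMap.range (S : A →ₗ[ℝ] F)) := FiniteDimensional.complete ℝ _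
  let R : A →L[ℝ] LinearMap.range (S : A →ₗ[ℝ] F) :=
    S.codRestrict _ fun a => LinearMap.mem_range_self (S : A →ₗ[ℝ] F) a
  have hR : Function.Surjective R := by
    rintro ⟨_, a, rfl⟩
    exact ⟨a, rfl⟩
  obtain ⟨C, hC, h⟩ := R.exists_preimage_norm_le hR
  refine ⟨C, hC, fun a => ?_⟩
  obtain ⟨a', h1, h2⟩ := h (R a)
  exact ⟨a', congrArg Subtype.val h1, h2⟩

namespace RationalNorm

variable {k l : ℕ}

/-- The shift, as an operator between rational Banach spaces. -/
noncomputable def shiftL (p : RationalNorm (k + l)) (q : RationalNorm l) :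
    p.Space →L[ℝ] q.Space :=
  LinearMap.toContinuousLinearMap
    (q.coord.symm.toLinearMap ∘ₗ shift k l ∘ₗ p.coord.toLinearMap)

theorem isStandardOperator_shiftL (p : RationalNorm (k + l)) (q : RationalNorm l) :
    IsStandardOperator (shiftL p q) := by
  refine ⟨k, by omega, by omega, fun x i => ?_⟩
  rw [dif_pos (by omega)]
  rfl

theorem isStandardSubspace_top {n : ℕ} (p : RationalNorm n) : p.IsStandardSubspace ⊤ := by
  refine ⟨Set.univ, ?_⟩
  have h := (Pi.basisFun ℝ (Fin n)).span_eq
  have h2 : ⇑(Pi.basisFun ℝ (Fin n)) = p.stdVec := funext fun i => Pi.basisFun_apply ℝ (Fin n) i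
  rw [Set.image_univ, ← h2]
  exact h.symm

/-- Two norms on `ℝᵏ⁺ˡ` and `ℝˡ` for which the shift is nonexpansive have rational approximations
with the same property. -/
theorem exists_shiftL_nonexpansive {A B : Type*} [NormedAddCommGroup A] [NormedSpace ℝ A]
    [NormedAddCommGroup B] [NormedSpace ℝ B] (L : (Fin (k + l) → ℝ) ≃L[ℝ] A)
    (M : (Fin l → ℝ) ≃L[ℝ] B) (h : ∀ x, ‖M (shift k l x)‖ ≤ ‖L x‖) {η : ℝ} (hη : 0 < η) :
    ∃ (p : RationalNorm (k + l)) (q : RationalNorm l), ‖shiftL p q‖ ≤ 1 ∧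
      (∀ x, ‖L (p.coord x)‖ ≤ ‖x‖) ∧ (∀ x : p.Space, ‖x‖ ≤ (1 + η) * ‖L (p.coord x)‖) ∧
      (∀ y, ‖M (q.coord y)‖ ≤ ‖y‖) ∧ (∀ y : q.Space, ‖y‖ ≤ (1 + η) * ‖M (q.coord y)‖) := by
  classical
  obtain ⟨p, hp1, hp2, -⟩ := exists_rationalNorm_approx L hη ∅ (by simp)
  obtain ⟨F, hF⟩ := p.rational'
  let sq : (Fin (k + l) → ℚ) → Fin l → ℚ := fun x i => x ⟨i + k, by omega⟩
  have hsq : ∀ x : Fin (k + l) → ℚ, (fun i => (sq x i : ℝ)) = shift k l fun i => (x i : ℝ) :=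
    fun x => rfl
  obtain ⟨q, hq1, hq2, hq3⟩ := exists_rationalNorm_approx M hη (F.image sq) (by
    intro y hy
    obtain ⟨x, hx, rfl⟩ := Finset.mem_image.1 hy
    rw [hsq]
    refine (h _).trans ((hp1 _).trans ?_)
    have : (fun i => (x i : ℝ)) ∈ {x | p.toFun x ≤ 1} := by
      rw [hF]
      exact subset_convexHull ℝ _ ⟨x, hx, rfl⟩
    exact this)
  refine ⟨p, q, ContinuousLinearMap.opNorm_le_bound _ zero_le_one fun x => ?_, hp1, hp2, hq1, hq2⟩
  rw [one_mul]
  refine seminorm_le_of_unitBall_subset (p := p.toSeminorm)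
    (q := q.toSeminorm.comp (shift k l)) (fun x hx => ?_) (p.coord x)
  have hx' : x ∈ convexHull ℝ
      ((fun (q : Fin (k + l) → ℚ) i => (q i : ℝ)) '' (F : Set (Fin (k + l) → ℚ))) := by
    rw [← hF]
    exact hx
  have hc : Convex ℝ {x | q.toSeminorm.comp (shift k l) x ≤ 1} := by
    have := (q.toSeminorm.comp (shift k l)).convex_closedBall 0 1
    rwa [Seminorm.closedBall_zero_eq] at this
  refine convexHull_min ?_ hc hx'
  rintro _ ⟨y, hy, rfl⟩
  exact hq3 (sq y) (Finset.mem_image_of_mem _ hy)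

end RationalNorm

/-! ### Approximate extension from (GC) -/

theorem isEpsIsometricEmbedding_of_le_one {X F : Type*} [NormedAddCommGroup X] [NormedSpace ℝ X]
    [NormedAddCommGroup F] [NormedSpace ℝ F] {T : X →L[ℝ] F} {δ : ℝ} (hδ : δ ≤ 1)
    (h : ∀ x, x ≠ 0 → (1 - δ) * ‖x‖ < ‖T x‖ ∧ ‖T x‖ < (1 + δ) * ‖x‖) :
    IsEpsIsometricEmbedding δ T := by
  refine ⟨(injective_iff_map_eq_zero T).2 fun x hx => ?_, h⟩
  by_contra h0
  have h1 := (h x h0).1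
  rw [hx, norm_zero] at h1
  exact absurd h1 (not_lt.2 (mul_nonneg (by linarith) (norm_nonneg x)))

/-- An operator that is `η`-close to an isometry, with respect to a norm `‖L x‖` that is
`(1 + η)`-close to the given one, is almost isometric. -/
theorem isEpsIsometricEmbedding_of_approx {X A F : Type*} [NormedAddCommGroup X] [NormedSpace ℝ X]
    [NormedAddCommGroup A] [NormedAddCommGroup F] [NormedSpace ℝ F]
    {L : X → A} {T : X →L[ℝ] F} {η δ : ℝ} (hη : 0 ≤ η) (hηδ : 2 * η < δ) (hδ : δ ≤ 1)
    (hL1 : ∀ x, ‖L x‖ ≤ ‖x‖) (hL2 : ∀ x, ‖x‖ ≤ (1 + η) * ‖L x‖)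
    (hT : ∀ x, |‖T x‖ - ‖L x‖| ≤ η * ‖L x‖) : IsEpsIsometricEmbedding δ T := by
  refine isEpsIsometricEmbedding_of_le_one hδ fun x hx => ?_
  have h0 : 0 < ‖x‖ := norm_pos_iff.2 hx
  have h1 := hL1 x
  have h2 := hL2 x
  obtain ⟨h3, h4⟩ := abs_le.1 (hT x)
  have h5 : η * ‖L x‖ ≤ η * ‖x‖ := by gcongr
  have h6 : 2 * η * ‖x‖ < δ * ‖x‖ := by gcongr
  have h7 : 0 ≤ η * ‖x‖ := by positivity
  constructor <;> linarith

/-- The condition (GC) yields approximate lifts through `G` that approximately extend a given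
isometric embedding of a subspace. -/
theorem ConditionGC.exists_approx_extension {𝔾 : Type*} [NormedAddCommGroup 𝔾] [NormedSpace ℝ 𝔾]
    {D : Set 𝔾} (hD : Dense D) {G : 𝔾 →L[ℝ] 𝔾} (hG : ‖G‖ ≤ 1) (hGC : ConditionGC D G)
    {A : Type*} [NormedAddCommGroup A] [NormedSpace ℝ A] [FiniteDimensional ℝ A]
    (A₀ : Submodule ℝ A) (S : A →L[ℝ] 𝔾) (hS : ‖S‖ ≤ 1) (i₀ : A₀ →ₗᵢ[ℝ] 𝔾)
    (hi₀ : ∀ a : A₀, G (i₀ a) = S a) {ε : ℝ} (hε : 0 < ε) :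
    ∃ i : A →L[ℝ] 𝔾, (∀ a, (1 - ε) * ‖a‖ ≤ ‖i a‖) ∧ (∀ a, ‖i a‖ ≤ (1 + ε) * ‖a‖) ∧
      (∀ a : A₀, ‖i a - i₀ a‖ ≤ ε * ‖a‖) ∧ ∀ a, ‖G (i a) - S a‖ ≤ ε * ‖a‖ := by
  obtain ⟨e, he0, heε⟩ := exists_rat_btwn (show (0 : ℝ) < min 1 (ε / 8) by positivity)
  have he1 : (e : ℝ) ≤ 1 := heε.le.trans (min_le_left _ _)
  have he8 : (e : ℝ) ≤ ε / 8 := heε.le.trans (min_le_right _ _)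
  obtain ⟨k, l, L', M', I, hLM', hI⟩ := exists_adapted_coordinates (S : A →ₗ[ℝ] 𝔾) A₀
  let L : (Fin (k + l) → ℝ) ≃L[ℝ] A := L'.toContinuousLinearEquiv
  let M : (Fin l → ℝ) ≃L[ℝ] LinearMap.range (S : A →ₗ[ℝ] 𝔾) := M'.toContinuousLinearEquiv
  have hLM : ∀ x, (M (shift k l x) : 𝔾) = S (L x) := hLM'
  have hMnorm : ∀ x, ‖M (shift k l x)‖ ≤ ‖L x‖ := fun x => by
    rw [Submodule.coe_norm, hLM]
    simpa using S.le_of_opNorm_le hS (L x)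
  obtain ⟨C, hC, hpre⟩ := exists_preimage_norm_le_of_finiteDimensional (S ∘L A₀.subtypeL)
  -- A lower bound for `δ(ε, n, m, t)` that holds for all sufficiently precise rational norms.
  let d : ℝ := e / (1 + 2 * ((((k + l : ℕ) : ℝ) + 1) *
    max 1 (2 * C * √(((k + l : ℕ) : ℝ) * (l : ℝ)))))
  have hd0 : 0 < d := by positivity
  have hde : d ≤ e := div_le_self he0.le (le_add_of_nonneg_right (by positivity))
  let η : ℝ := d / 4
  have hη : 0 < η := by positivity
  have hηd : 4 * η = d := by simp only [η]; ring
  have hη1 : η < 1 := by linarith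
  obtain ⟨p, q, hT, hp1, hp2, hq1, hq2⟩ := RationalNorm.exists_shiftL_nonexpansive L M hMnorm hη
  obtain ⟨P, hP⟩ := Submodule.ClosedComplemented.of_finiteDimensional A₀
  obtain ⟨ψ, hψD, hψ⟩ := exists_perturbation_into_dense L (i₀.toContinuousLinearMap ∘L P) hD hη
  obtain ⟨χ, hχD, hχ⟩ := exists_perturbation_into_dense M
    (LinearMap.range (S : A →ₗ[ℝ] 𝔾)).subtypeL hD hη
  have hψ₀ : ∀ a : A₀, ‖ψ a - i₀ a‖ ≤ η * ‖a‖ := fun a => by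
    have := hψ a
    rwa [ContinuousLinearMap.comp_apply, hP] at this
  let Lp : p.Space →L[ℝ] A :=
    LinearMap.toContinuousLinearMap (L'.toLinearMap ∘ₗ p.coord.toLinearMap)
  let Mq : q.Space →L[ℝ] LinearMap.range (S : A →ₗ[ℝ] 𝔾) :=
    LinearMap.toContinuousLinearMap (M'.toLinearMap ∘ₗ q.coord.toLinearMap)
  have hMT : ∀ x, (Mq (RationalNorm.shiftL p q x) : 𝔾) = S (Lp x) := fun x => hLM (p.coord x)
  let X₀ : Submodule ℝ p.Space := A₀.comap (Lp : p.Space →ₗ[ℝ] A)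
  have hX₀ : p.IsStandardSubspace X₀ := ⟨I, hI⟩
  let T₀ : X₀ →L[ℝ] (⊤ : Submodule ℝ q.Space) :=
    (RationalNorm.shiftL p q ∘L X₀.subtypeL).codRestrict ⊤ fun _ => trivial
  let f : X₀ →L[ℝ] 𝔾 := ψ ∘L Lp ∘L X₀.subtypeL
  let g : (⊤ : Submodule ℝ q.Space) →L[ℝ] 𝔾 := χ ∘L Mq ∘L Submodule.subtypeL _
  have ht : (opennessNorm T₀).toReal ≤ 2 * C := by
    have h : opennessNorm T₀ ≤ ((2 * C).toNNReal : ℝ≥0∞) := by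
      refine sInf_le (Or.inl ⟨_, ?_, rfl⟩)
      rintro _ ⟨⟨x, rfl⟩, hx⟩
      have hx1 : ‖T₀ x‖ < 1 := mem_ball_zero_iff.1 hx
      obtain ⟨a', ha', hn⟩ := hpre ⟨Lp x, x.2⟩
      have ha' : S a' = S (Lp x) := ha'
      have hn : ‖a'‖ ≤ C * ‖S (Lp x)‖ := hn
      let x' : p.Space := p.coord.symm (L.symm a')
      have hx' : Lp x' = a' := L.apply_symm_apply a'
      have hx'm : x' ∈ X₀ := by
        change Lp x' ∈ A₀
        rw [hx']
        exact a'.2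
      have hTx : T₀ ⟨x', hx'm⟩ = T₀ x := by
        refine Subtype.ext (q.coord.injective (M.injective (Subtype.ext ?_)))
        have h1 := hMT x'
        rw [hx', ha', ← hMT x] at h1
        exact h1
      refine ⟨⟨x', hx'm⟩, mem_ball_zero_iff.2 ?_, hTx⟩
      rw [Real.coe_toNNReal _ (by positivity)]
      have h2 : ‖S (Lp x)‖ < 1 := by
        rw [← hMT]
        exact (hq1 _).trans_lt hx1
      calc ‖x'‖ ≤ (1 + η) * ‖Lp x'‖ := hp2 x'
        _ ≤ (1 + 1) * (C * ‖S (Lp x)‖) := by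
          rw [hx']
          gcongr
          exact hn
        _ < (1 + 1) * (C * 1) := by gcongr
        _ = 2 * C := by ring
    have h1 := ENNReal.toReal_mono ENNReal.coe_ne_top h
    rwa [ENNReal.coe_toReal, Real.coe_toNNReal _ (by positivity)] at h1
  have hX₀d : Module.finrank ℝ X₀ ≤ k + l := by
    refine (Submodule.finrank_le X₀).trans_eq ?_
    rw [p.coord.finrank_eq, Module.finrank_fin_fun]
  have hYd : Module.finrank ℝ (⊤ : Submodule ℝ q.Space) ≤ l := by
    rw [finrank_top, q.coord.finrank_eq, Module.finrank_fin_fun]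
  have hdδ : d ≤ delta e (Module.finrank ℝ X₀) (Module.finrank ℝ (⊤ : Submodule ℝ q.Space))
      (opennessNorm T₀).toReal :=
    le_delta he0 he1 (Nat.cast_nonneg _) (by exact_mod_cast hX₀d) (Nat.cast_nonneg _)
      (by exact_mod_cast hYd) ENNReal.toReal_nonneg ht
  have hf : ∀ x : X₀, ‖f x - i₀ ⟨Lp x, x.2⟩‖ ≤ η * ‖Lp x‖ := fun x => hψ₀ ⟨Lp x, x.2⟩
  have hg : ∀ y, ‖g y - Mq y‖ ≤ η * ‖Mq y‖ := fun y => hχ (Mq y)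
  have hf_iso : IsEpsIsometricEmbedding d f :=
    isEpsIsometricEmbedding_of_approx (L := fun x : X₀ => Lp x) hη.le (by linarith) (by linarith)
      (fun x => hp1 x) (fun x => hp2 x) fun x => by
        have h1 := (abs_norm_sub_norm_le _ _).trans (hf x)
        rwa [i₀.norm_map] at h1
  have hg_iso : IsEpsIsometricEmbedding d g :=
    isEpsIsometricEmbedding_of_approx (L := fun y : (⊤ : Submodule ℝ q.Space) => Mq y) hη.le
      (by linarith) (by linarith) (fun y => hq1 y) (fun y => hq2 y) fun y =>
        (abs_norm_sub_norm_le _ _).trans (hg y)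
  have hgT : ∀ x, ‖χ (Mq (RationalNorm.shiftL p q x)) - S (Lp x)‖ ≤ η * ‖Lp x‖ := fun x => by
    have h1 := hχ (Mq (RationalNorm.shiftL p q x))
    rw [Submodule.subtypeL_apply, Submodule.coe_norm, hMT] at h1
    refine h1.trans ?_
    gcongr
    simpa using S.le_of_opNorm_le hS (Lp x)
  let t : StandardTuple D :=
    { ε := e
      ε_pos := by exact_mod_cast he0
      ε_le_one := by exact_mod_cast he1
      X := p
      Y := q
      T := RationalNorm.shiftL p q
      T_nonexpansive := hT
      T_standard := RationalNorm.isStandardOperator_shiftL p q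
      X₀ := X₀
      Y₀ := ⊤
      X₀_standard := hX₀
      Y₀_standard := RationalNorm.isStandardSubspace_top q
      T₀ := T₀
      T₀_apply := fun _ => rfl
      i₀ := f
      j₀ := g
      i₀_isometric := hf_iso.mono hdδ
      j₀_isometric := hg_iso.mono hdδ
      i₀_mem := by
        rintro x ⟨i, hi⟩
        change ψ (Lp x) ∈ D
        rw [← hi]
        exact hψD i
      j₀_mem := by
        rintro y ⟨i, hi⟩
        change χ (Mq y) ∈ D
        rw [← hi]
        exact hχD i }
  have hcomm : ‖G ∘L f - g ∘L T₀‖ < delta e (Module.finrank ℝ X₀)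
      (Module.finrank ℝ (⊤ : Submodule ℝ q.Space)) (opennessNorm T₀).toReal := by
    refine lt_of_le_of_lt (ContinuousLinearMap.opNorm_le_bound _ (by positivity : 0 ≤ 2 * η)
      fun x => ?_) (lt_of_lt_of_le (by linarith) hdδ)
    have h1 : (G ∘L f - g ∘L T₀) x = G (f x - i₀ ⟨Lp x, x.2⟩) -
        (χ (Mq (RationalNorm.shiftL p q x)) - S (Lp x)) := by
      rw [map_sub, hi₀, sub_sub_sub_cancel_right]
      rfl
    have h2 := (G.le_of_opNorm_le hG (f x - i₀ ⟨Lp x, x.2⟩))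
    rw [one_mul] at h2
    rw [h1]
    refine (norm_sub_le _ _).trans ?_
    have h3 : η * ‖Lp x‖ ≤ η * ‖x‖ := by
      gcongr
      exact hp1 x
    linarith [hgT x, hf x]
  obtain ⟨i, j, hi, hj, hi', hj', hij⟩ := hGC t hcomm
  let Lpi : A →L[ℝ] p.Space := LinearMap.toContinuousLinearMap
    (p.coord.symm.toLinearMap ∘ₗ L'.symm.toLinearMap)
  have hLp : ∀ a, Lp (Lpi a) = a := fun a => L'.apply_symm_apply a
  have hLpn : ∀ a, ‖Lpi a‖ ≤ (1 + η) * ‖a‖ := fun a => by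
    have := hp2 (Lpi a)
    rwa [show L (p.coord (Lpi a)) = a from hLp a] at this
  have hLpn' : ∀ a, ‖a‖ ≤ ‖Lpi a‖ := fun a => by
    have := hp1 (Lpi a)
    rwa [show L (p.coord (Lpi a)) = a from hLp a] at this
  have hηe : η ≤ e := by linarith
  -- The errors in the four estimates are multiples of `e * ‖a‖`, with total factor at most `8`.
  have heL : ∀ a, e * ‖Lpi a‖ ≤ 2 * e * ‖a‖ := fun a => by
    have h1 : e * ‖Lpi a‖ ≤ e * ((1 + η) * ‖a‖) := by
      gcongr
      exact hLpn a
    have h2 : e * ((1 + η) * ‖a‖) ≤ e * (2 * ‖a‖) := by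
      gcongr
      linarith
    linarith
  have heε : ∀ a : A, 8 * (e * ‖a‖) ≤ ε * ‖a‖ := fun a => by
    have : 8 * (e : ℝ) ≤ ε := by linarith
    rw [← mul_assoc]
    gcongr
  have hηe' : ∀ a : A, η * ‖a‖ ≤ e * ‖a‖ := fun a => by gcongr
  have he' : ∀ a : A, 0 ≤ e * ‖a‖ := fun a => by positivity
  refine ⟨i ∘L Lpi, fun a => ?_, fun a => ?_, fun a => ?_, fun a => ?_⟩
  · have h1 : (1 - e) * ‖Lpi a‖ ≤ ‖i (Lpi a)‖ := hi.le_norm_apply (Lpi a)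
    have h2 : (1 - e) * ‖a‖ ≤ (1 - e) * ‖Lpi a‖ :=
      mul_le_mul_of_nonneg_left (hLpn' a) (by linarith)
    have := heε a
    have := he' a
    have h3 : (1 - ε) * ‖a‖ ≤ ‖i (Lpi a)‖ := by linarith
    exact h3
  · have h1 : ‖i (Lpi a)‖ ≤ (1 + e) * ‖Lpi a‖ := hi.norm_apply_le (Lpi a)
    have h3 : ‖i (Lpi a)‖ ≤ (1 + ε) * ‖a‖ := by
      linarith [heL a, heε a, he' a, hLpn a, hηe' a]
    exact h3
  · have hmem : Lpi a ∈ X₀ := by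
      change Lp (Lpi a) ∈ A₀
      rw [hLp]
      exact a.2
    have h1 : ‖i (Lpi a) - f ⟨Lpi a, hmem⟩‖ ≤ e * ‖Lpi a‖ :=
      (i ∘L X₀.subtypeL - f).le_of_opNorm_le hi'.le ⟨Lpi a, hmem⟩
    have h2 : ‖f ⟨Lpi a, hmem⟩ - i₀ a‖ ≤ η * ‖(a : A)‖ := by
      have : f ⟨Lpi a, hmem⟩ = ψ a := congrArg ψ (hLp a)
      rw [this]
      exact hψ₀ a
    have h3 := norm_sub_le_norm_sub_add_norm_sub (i (Lpi a)) (f ⟨Lpi a, hmem⟩) (i₀ a)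
    have h4 : ‖i (Lpi a) - i₀ a‖ ≤ ε * ‖(a : A)‖ := by
      linarith [heL a, heε a, he' a, hηe' a]
    exact h4
  · let y := RationalNorm.shiftL p q (Lpi a)
    have h1 : ‖G (i (Lpi a)) - j y‖ ≤ e * ‖Lpi a‖ :=
      (G ∘L i - j ∘L RationalNorm.shiftL p q).le_of_opNorm_le hij.le (Lpi a)
    have h2 : ‖j y - χ (Mq y)‖ ≤ e * ‖Lpi a‖ := by
      have h5 : ‖j y - χ (Mq y)‖ ≤ e * ‖y‖ :=
        (j ∘L (⊤ : Submodule ℝ q.Space).subtypeL - g).le_of_opNorm_le hj'.le ⟨y, trivial⟩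
      refine h5.trans ?_
      gcongr
      simpa using (RationalNorm.shiftL p q).le_of_opNorm_le hT (Lpi a)
    have h3 : ‖χ (Mq y) - S a‖ ≤ η * ‖a‖ := by
      have := hgT (Lpi a)
      rwa [hLp] at this
    have h4 := norm_sub_le_norm_sub_add_norm_sub (G (i (Lpi a))) (j y) (S a)
    have h5 := norm_sub_le_norm_sub_add_norm_sub (j y) (χ (Mq y)) (S a)
    have h6 : ‖G (i (Lpi a)) - S a‖ ≤ ε * ‖a‖ := by
      linarith [heL a, heε a, he' a, hηe' a]
    exact h6

/-! ### From approximate to exact lifts -/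

section Lift

variable {𝔾 : Type*} [NormedAddCommGroup 𝔾] [NormedSpace ℝ 𝔾] {D : Set 𝔾} {G : 𝔾 →L[ℝ] 𝔾}
  {A : Type*} [NormedAddCommGroup A] [NormedSpace ℝ A] [FiniteDimensional ℝ A]
  {A₀ : Submodule ℝ A}

/-- An `e`-approximate lift `i` of `S` through `G`, which is exact on `A₀`, is at distance `O(e)`
from an `e'`-approximate one with the same restriction to `A₀`, for every `e' > 0`. The implied
constant depends only on a projection `P` onto `A₀`.

Approximate extension is applied to `X = Z ⊕₁ A`, where `Z` is the range of `i`, to the inclusion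
of `Z`, and to the operator `(z, a) ↦ G z + e⁻¹ (S a - G (i a))`. The latter is nonexpansive and
maps `(i a, e (a - P a))` exactly to `S a`. -/
theorem ConditionGC.exists_better_lift (hD : Dense D) (hG : ‖G‖ ≤ 1) (hGC : ConditionGC D G)
    (P : A →L[ℝ] A₀) (hP : ∀ a : A₀, P a = a) (S i : A →L[ℝ] 𝔾)
    (hiS : ∀ a : A₀, G (i a) = S a) {e e' : ℝ} (he : 0 < e) (he' : 0 < e')
    (hie : ∀ a, ‖G (i a) - S a‖ ≤ e * ‖a‖) :
    ∃ i' : A →L[ℝ] 𝔾, (∀ a : A₀, i' a = i a) ∧ (∀ a, ‖G (i' a) - S a‖ ≤ e' * ‖a‖) ∧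
      ‖i' - i‖ ≤ (1 + 2 * ‖ContinuousLinearMap.id ℝ A - A₀.subtypeL ∘L P‖) *
        ‖ContinuousLinearMap.id ℝ A - A₀.subtypeL ∘L P‖ * e := by
  set Q : A →L[ℝ] A := ContinuousLinearMap.id ℝ A - A₀.subtypeL ∘L P with hQ
  have hQa : ∀ a, Q a = a - P a := fun a => rfl
  have hQ₀ : ∀ a : A₀, Q a = 0 := fun a => by rw [hQa, hP, sub_self]
  let K : ℝ := 1 + ‖i‖ + e * ‖Q‖ + ‖i‖ * ‖P‖
  have hK : 0 < K := by positivity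
  let ε : ℝ := min 1 (min e e' / K)
  have hε : 0 < ε := by positivity
  have hε1 : ε ≤ 1 := min_le_left _ _
  have hεK : ε * K ≤ min e e' := by
    rw [← le_div_iff₀ hK]
    exact min_le_right _ _
  have hεK' : ε * K = ε + ε * ‖i‖ + ε * (e * ‖Q‖) + ε * (‖i‖ * ‖P‖) := by
    simp only [K]; ring
  have h0 : 0 ≤ ε * (e * ‖Q‖) := by positivity
  have h0' : 0 ≤ ε * (‖i‖ * ‖P‖) := by positivity
  have hεi : ε * ‖i‖ ≤ e := by linarith [hεK.trans (min_le_left _ _)]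
  have hεe' : ε * ‖i‖ + ε * (e * ‖Q‖) + ε * (‖i‖ * ‖P‖) ≤ e' := by
    linarith [hεK.trans (min_le_right _ _)]
  let Z : Submodule ℝ 𝔾 := LinearMap.range (i : A →ₗ[ℝ] 𝔾)
  let iZ : A →L[ℝ] Z := i.codRestrict Z fun a => LinearMap.mem_range_self (i : A →ₗ[ℝ] 𝔾) a
  have : FiniteDimensional ℝ (WithLp 1 (Z × A)) :=
    (WithLp.linearEquiv 1 ℝ (Z × A)).symm.finiteDimensional
  let Φ : Z × A →L[ℝ] WithLp 1 (Z × A) :=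
    ((WithLp.prodContinuousLinearEquiv 1 ℝ Z A).symm : Z × A →L[ℝ] WithLp 1 (Z × A))
  let T : WithLp 1 (Z × A) →L[ℝ] 𝔾 :=
    (G ∘L Z.subtypeL) ∘L WithLp.fstL 1 ℝ Z A + (e⁻¹ • (S - G ∘L i)) ∘L WithLp.sndL 1 ℝ Z A
  have hTΦ : ∀ z a, T (Φ (z, a)) = G z + e⁻¹ • (S a - G (i a)) := fun z a => rfl
  have hΦn : ∀ z a, ‖Φ (z, a)‖ = ‖z‖ + ‖a‖ := fun z a => WithLp.prod_norm_eq_of_L1 _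
  have hT : ‖T‖ ≤ 1 := by
    refine T.opNorm_le_bound zero_le_one fun x => ?_
    have h1 : ‖G x.fst‖ ≤ ‖x.fst‖ := by simpa using G.le_of_opNorm_le hG x.fst
    have h2 : ‖e⁻¹ • (S x.snd - G (i x.snd))‖ ≤ ‖x.snd‖ := by
      rw [norm_smul, Real.norm_of_nonneg (inv_nonneg.2 he.le), norm_sub_rev, inv_mul_le_iff₀ he]
      exact hie _
    rw [one_mul, WithLp.prod_norm_eq_of_L1]
    exact (norm_add_le _ _).trans (add_le_add h1 h2)
  let ιZ : Z →ₗᵢ[ℝ] WithLp 1 (Z × A) :=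
    ⟨(Φ ∘L ContinuousLinearMap.inl ℝ Z A : Z →ₗ[ℝ] WithLp 1 (Z × A)), fun z => by
      change ‖Φ (z, 0)‖ = ‖z‖
      rw [hΦn, norm_zero, add_zero]⟩
  have hιZ : ∀ z, ιZ z = Φ (z, 0) := fun z => rfl
  obtain ⟨j, -, hj1, hj2, hj3⟩ := hGC.exists_approx_extension hD hG ιZ.range T hT
    (Z.subtypeₗᵢ.comp ιZ.equivRange.symm.toLinearIsometry) (by
      rintro ⟨_, z, rfl⟩
      have h1 : ιZ.equivRange.symm ⟨ιZ z, z, rfl⟩ = z := ιZ.equivRange.symm_apply_apply z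
      refine (congrArg (fun w : Z => G w) h1).trans ?_
      change G z = T (Φ (z, 0))
      rw [hTΦ, map_zero, map_zero, map_zero, sub_self, smul_zero, add_zero]) hε
  have hjZ : ∀ z : Z, ‖j (Φ (z, 0)) - z‖ ≤ ε * ‖z‖ := fun z => by
    have h1 : ιZ.equivRange.symm ⟨ιZ z, z, rfl⟩ = z := ιZ.equivRange.symm_apply_apply z
    have h2 := hj2 ⟨ιZ z, z, rfl⟩
    have h3 : (Z.subtypeₗᵢ.comp ιZ.equivRange.symm.toLinearIsometry) ⟨ιZ z, z, rfl⟩ = z :=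
      congrArg Subtype.val h1
    rw [h3] at h2
    exact h2.trans_eq (congrArg (ε * ·) (ιZ.norm_map z))
  let i₂ : A →L[ℝ] 𝔾 := j ∘L Φ ∘L iZ.prod (e • Q)
  have hi₂ : ∀ a, i₂ a = j (Φ (iZ a, e • Q a)) := fun a => rfl
  have hiZ : ∀ a, ‖iZ a‖ ≤ ‖i‖ * ‖a‖ := fun a => i.le_opNorm a
  have heQ : ∀ a, ‖e • Q a‖ = e * ‖Q a‖ := fun a => by
    rw [norm_smul, Real.norm_of_nonneg he.le]
  -- `i₂` is close to `i`, and very close to it on `A₀`.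
  have hi₂i : ∀ a, ‖i₂ a - i a‖ ≤ ε * (‖i‖ * ‖a‖) + 2 * (e * ‖Q a‖) := by
    intro a
    have h1 : i₂ a - i a = (j (Φ (iZ a, 0)) - iZ a) + j (Φ (0, e • Q a)) := by
      have h2 : (iZ a, e • Q a) = (iZ a, (0 : A)) + ((0 : Z), e • Q a) := by simp
      rw [hi₂, h2, map_add, map_add, add_sub_right_comm]
      rfl
    rw [h1]
    refine (norm_add_le _ _).trans (add_le_add ((hjZ _).trans ?_) ((hj1 _).trans ?_))
    · gcongr
      exact hiZ a
    · rw [hΦn, norm_zero, zero_add, heQ]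
      gcongr
      linarith
  have hi₂₀ : ∀ a : A₀, ‖i₂ a - i a‖ ≤ ε * (‖i‖ * ‖a‖) := fun a => by
    have := hi₂i a
    rwa [hQ₀, norm_zero, mul_zero, mul_zero, add_zero] at this
  have hGi₂ : ∀ a, ‖G (i₂ a) - S a‖ ≤ ε * (‖i‖ * ‖a‖ + e * ‖Q a‖) := by
    intro a
    have h1 : T (Φ (iZ a, e • Q a)) = S a := by
      have h2 : S (P a : A) - G (i (P a)) = 0 := by rw [hiS, sub_self]
      rw [hTΦ, map_smul, map_smul, map_smul, ← smul_sub, inv_smul_smul₀ he.ne', hQa, map_sub,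
        map_sub, map_sub, sub_sub_sub_comm, h2, sub_zero]
      change G (i a) + (S a - G (i a)) = S a
      abel
    have h2 := hj3 (Φ (iZ a, e • Q a))
    rw [h1, hΦn, heQ] at h2
    refine h2.trans ?_
    gcongr
    exact hiZ a
  -- The restriction to `A₀` is corrected by means of the projection.
  refine ⟨i + (i₂ - i) ∘L Q, fun a => ?_, fun a => ?_, ?_⟩
  · simp [hQ₀]
  · have h1 : (i + (i₂ - i) ∘L Q) a = i₂ a - (i₂ (P a) - i (P a)) := by
      simp only [add_apply, ContinuousLinearMap.comp_apply, sub_apply, hQa, map_sub]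
      abel
    have h2 : ‖G (i₂ (P a) - i (P a))‖ ≤ ε * (‖i‖ * (‖P‖ * ‖a‖)) := by
      refine (G.le_of_opNorm_le hG _).trans ?_
      rw [one_mul]
      refine (hi₂₀ (P a)).trans ?_
      gcongr
      exact P.le_opNorm a
    rw [h1, map_sub, sub_right_comm]
    calc ‖G (i₂ a) - S a - G (i₂ (P a) - i (P a))‖
        ≤ ε * (‖i‖ * ‖a‖ + e * (‖Q‖ * ‖a‖)) + ε * (‖i‖ * (‖P‖ * ‖a‖)) := by
          refine (norm_sub_le _ _).trans (add_le_add ((hGi₂ a).trans ?_) h2)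
          gcongr
          exact Q.le_opNorm a
      _ = (ε * ‖i‖ + ε * (e * ‖Q‖) + ε * (‖i‖ * ‖P‖)) * ‖a‖ := by ring
      _ ≤ e' * ‖a‖ := by gcongr
  · rw [add_sub_cancel_left]
    have hQQ : ∀ a, Q (Q a) = Q a := fun a => by
      rw [hQa (Q a), hQa a, map_sub, hP, sub_self, Submodule.coe_zero, sub_zero]
    refine ContinuousLinearMap.opNorm_le_bound _ (by positivity) fun a => ?_
    calc ‖((i₂ - i) ∘L Q) a‖ ≤ ε * (‖i‖ * ‖Q a‖) + 2 * (e * ‖Q (Q a)‖) := hi₂i (Q a)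
      _ ≤ e * ‖Q a‖ + 2 * (e * (‖Q‖ * ‖Q a‖)) := by
        rw [← mul_assoc]
        gcongr
        exact Q.le_opNorm _
      _ = (1 + 2 * ‖Q‖) * e * ‖Q a‖ := by ring
      _ ≤ (1 + 2 * ‖Q‖) * e * (‖Q‖ * ‖a‖) := by
        gcongr
        exact Q.le_opNorm _
      _ = (1 + 2 * ‖Q‖) * ‖Q‖ * e * ‖a‖ := by ring

/-- An `e`-approximate lift through `G` that is exact on `A₀` is at distance `O(e)` from an exact
lift with the same restriction to `A₀`. -/
theorem ConditionGC.exists_exact_lift [CompleteSpace 𝔾] (hD : Dense D) (hG : ‖G‖ ≤ 1)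
    (hGC : ConditionGC D G) (A₀ : Submodule ℝ A) :
    ∃ C ≥ 0, ∀ (S i : A →L[ℝ] 𝔾), (∀ a : A₀, G (i a) = S a) → ∀ e > 0,
      (∀ a, ‖G (i a) - S a‖ ≤ e * ‖a‖) →
      ∃ i' : A →L[ℝ] 𝔾, (∀ a : A₀, i' a = i a) ∧ (∀ a, G (i' a) = S a) ∧ ‖i' - i‖ ≤ C * e := by
  obtain ⟨P, hP⟩ := Submodule.ClosedComplemented.of_finiteDimensional A₀
  let M := ‖ContinuousLinearMap.id ℝ A - A₀.subtypeL ∘L P‖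
  let C := (1 + 2 * M) * M
  have hM : 0 ≤ M := norm_nonneg _
  refine ⟨2 * C, by positivity, fun S i hiS e he hie => ?_⟩
  let good : ℕ → (A →L[ℝ] 𝔾) → Prop := fun n f =>
    (∀ a : A₀, f a = i a) ∧ ∀ a, ‖G (f a) - S a‖ ≤ e * (1 / 2) ^ n * ‖a‖
  have step : ∀ n f, good n f → ∃ f', good (n + 1) f' ∧ ‖f' - f‖ ≤ C * e * (1 / 2) ^ n := by
    rintro n f ⟨hf1, hf2⟩
    obtain ⟨f', h1, h2, h3⟩ := hGC.exists_better_lift hD hG P hP S f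
      (fun a => by rw [hf1, hiS]) (e := e * (1 / 2) ^ n) (e' := e * (1 / 2) ^ (n + 1))
      (by positivity) (by positivity) hf2
    exact ⟨f', ⟨fun a => (h1 a).trans (hf1 a), h2⟩, h3.trans_eq (mul_assoc C e _).symm⟩
  choose next hnext hdist using step
  let seq : (n : ℕ) → {f // good n f} := fun n =>
    Nat.rec ⟨i, fun _ => rfl, fun a => by simpa using hie a⟩
      (fun n f => ⟨next n f.1 f.2, hnext n f.1 f.2⟩) n
  have hseq : ∀ n, dist (seq n).1 (seq (n + 1)).1 ≤ C * e * (1 / 2) ^ n := fun n => by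
    rw [dist_comm, dist_eq_norm]
    exact hdist n (seq n).1 (seq n).2
  obtain ⟨f, hf⟩ := cauchySeq_tendsto_of_complete
    (cauchySeq_of_le_geometric (1 / 2) (C * e) (by norm_num) hseq)
  have hlim : ∀ a, Filter.Tendsto (fun n => (seq n).1 a) Filter.atTop (nhds (f a)) := fun a =>
    ((ContinuousLinearMap.apply ℝ 𝔾 a).continuous.tendsto f).comp hf
  refine ⟨f, fun a => ?_, fun a => ?_, ?_⟩
  · refine tendsto_nhds_unique (hlim a) ?_
    simp only [(seq _).2.1 a]
    exact tendsto_const_nhds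
  · have h1 := (((G.continuous.tendsto _).comp (hlim a)).sub_const (S a)).norm
    have h2 : Filter.Tendsto (fun n : ℕ => e * (1 / 2) ^ n * ‖a‖) Filter.atTop (nhds 0) := by
      have := ((tendsto_pow_atTop_nhds_zero_of_lt_one (r := (1 / 2 : ℝ)) (by norm_num)
        (by norm_num)).const_mul e).mul_const ‖a‖
      simpa using this
    have h3 := le_of_tendsto_of_tendsto' h1 h2 fun n => (seq n).2.2 a
    exact sub_eq_zero.1 (norm_le_zero_iff.1 h3)
  · have h1 := dist_le_of_le_geometric_of_tendsto₀ (1 / 2) (C * e) (by norm_num) hseq hf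
    rw [dist_comm, dist_eq_norm] at h1
    refine h1.trans_eq ?_
    ring

/-- The Gurarii property for lifts: an isometric embedding of a subspace extends to an almost
isometric embedding that is an exact lift of a given nonexpansive operator. -/
theorem ConditionGC.exists_isometric_lift [CompleteSpace 𝔾] (hD : Dense D) (hG : ‖G‖ ≤ 1)
    (hGC : ConditionGC D G) (A₀ : Submodule ℝ A) (S : A →L[ℝ] 𝔾) (hS : ‖S‖ ≤ 1)
    (i₀ : A₀ →ₗᵢ[ℝ] 𝔾) (hi₀ : ∀ a : A₀, G (i₀ a) = S a) {ε : ℝ} (hε : 0 < ε) :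
    ∃ i : A →L[ℝ] 𝔾, IsEpsIsometricEmbedding ε i ∧ (∀ a : A₀, i a = i₀ a) ∧
      ∀ a, G (i a) = S a := by
  obtain ⟨P, hP⟩ := Submodule.ClosedComplemented.of_finiteDimensional A₀
  obtain ⟨C, hC, hlift⟩ := hGC.exists_exact_lift hD hG A₀
  let δ : ℝ := min ε 1
  have hδ : 0 < δ := by positivity
  let e : ℝ := δ / (2 * ((1 + ‖P‖) * (1 + C)))
  have he : 0 < e := by positivity
  have heδ : e * ((1 + ‖P‖) * (1 + C)) = δ / 2 := by
    simp only [e]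
    field_simp
  obtain ⟨f, hf1, hf2, hf3, hf4⟩ := hGC.exists_approx_extension hD hG A₀ S hS i₀ hi₀ he
  let g : A →L[ℝ] 𝔾 := f + (i₀.toContinuousLinearMap - f ∘L A₀.subtypeL) ∘L P
  have hgf : ∀ a, ‖g a - f a‖ ≤ e * (‖P‖ * ‖a‖) := fun a => by
    have h1 : g a - f a = -(f (P a) - i₀ (P a)) := by simp [g]
    rw [h1, norm_neg]
    refine (hf3 (P a)).trans ?_
    gcongr
    exact P.le_opNorm a
  have hg₀ : ∀ a : A₀, g a = i₀ a := fun a => by simp [g, hP]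
  obtain ⟨i, hi1, hi2, hi3⟩ := hlift S g (fun a => by rw [hg₀, hi₀]) (e * (1 + ‖P‖))
    (by positivity) fun a => by
      have h1 : ‖G (g a - f a)‖ ≤ e * (‖P‖ * ‖a‖) := by
        refine (G.le_of_opNorm_le hG _).trans ?_
        rw [one_mul]
        exact hgf a
      rw [map_sub] at h1
      have h2 := norm_sub_le_norm_sub_add_norm_sub (G (g a)) (G (f a)) (S a)
      linarith [hf4 a]
  have key : ∀ a, |‖i a‖ - ‖a‖| ≤ δ / 2 * ‖a‖ := fun a => by
    have h1 : ‖i a - g a‖ ≤ C * (e * (1 + ‖P‖)) * ‖a‖ := (i - g).le_of_opNorm_le hi3 a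
    have h2 := norm_sub_le_norm_sub_add_norm_sub (i a) (g a) (f a)
    have h3 := abs_le.1 (abs_norm_sub_norm_le (i a) (f a))
    have h4 : C * (e * (1 + ‖P‖)) * ‖a‖ + e * (‖P‖ * ‖a‖) + e * ‖a‖ = δ / 2 * ‖a‖ := by
      rw [← heδ]
      ring
    rw [abs_le]
    constructor <;> linarith [hf1 a, hf2 a, hgf a]
  have hi : IsEpsIsometricEmbedding δ i :=
    isEpsIsometricEmbedding_of_le_one (min_le_right _ _) fun a ha => by
      have h1 := abs_le.1 (key a)
      have h2 : 0 < δ * ‖a‖ := mul_pos hδ (norm_pos_iff.2 ha)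
      constructor <;> linarith
  exact ⟨i, hi.mono (min_le_left _ _), fun a => (hi1 a).trans (hg₀ a), hi2⟩

end Lift

/-! ### From (GC) to Gurarii operators -/

/-- First `j₀` is extended to `j` by the Gurarii property of the space; then `j ∘ T` is lifted
through `G`. As `j ∘ T` need not be nonexpansive, `A` is replaced by the graph of `j ∘ T` with the
maximum norm, which agrees with the norm of `A` on `A₀`. -/
theorem ConditionGC.isGurariiOperator {𝔾 : Type*} [NormedAddCommGroup 𝔾] [NormedSpace ℝ 𝔾]
    [CompleteSpace 𝔾] (h𝔾 : IsGurariiSpace 𝔾) {D : Set 𝔾} (hD : Dense D) {G : 𝔾 →L[ℝ] 𝔾}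
    (hG : ‖G‖ ≤ 1) (hGC : ConditionGC D G) : IsGurariiOperator G := by
  refine ⟨hG, ?_⟩
  intro ε hε A B _ _ _ _ _ _ T hT A₀ B₀ hTA i₀ j₀ hcomm
  let δ : ℝ := min (ε / 3) (1 / 3)
  have hδ : 0 < δ := by positivity
  have hδε : δ ≤ ε / 3 := min_le_left _ _
  have hδ1 : δ ≤ 1 / 3 := min_le_right _ _
  obtain ⟨j, hj, hj₀⟩ := h𝔾 B B₀ δ hδ j₀
  let U : A →L[ℝ] 𝔾 := j ∘L T
  have hU : ∀ a, ‖U a‖ ≤ (1 + δ) * ‖a‖ := fun a => by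
    refine (hj.norm_apply_le (T a)).trans ?_
    gcongr
    simpa using T.le_of_opNorm_le hT a
  have hU₀ : ∀ a : A₀, G (i₀ a) = U a := fun a =>
    (hcomm a).trans (hj₀ ⟨T a, hTA a a.2⟩).symm
  let V : A →L[ℝ] A × 𝔾 := (ContinuousLinearMap.id ℝ A).prod U
  let Γ : Submodule ℝ (A × 𝔾) := LinearMap.range (V : A →ₗ[ℝ] A × 𝔾)
  let c : A →L[ℝ] Γ := V.codRestrict Γ fun a => LinearMap.mem_range_self (V : A →ₗ[ℝ] A × 𝔾) a
  have hc : ∀ a, ‖c a‖ = max ‖a‖ ‖U a‖ := fun a => rfl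
  have hc1 : ∀ a, ‖a‖ ≤ ‖c a‖ := fun a => le_max_left _ _
  have hc2 : ∀ a, ‖c a‖ ≤ (1 + δ) * ‖a‖ := fun a =>
    (hc a).trans_le (max_le (le_mul_of_one_le_left (norm_nonneg a) (by linarith)) (hU a))
  let ι : A₀ →ₗᵢ[ℝ] Γ := ⟨(c ∘L A₀.subtypeL : A₀ →ₗ[ℝ] Γ), fun a => by
    change ‖c a‖ = ‖a‖
    rw [hc, ← hU₀]
    refine max_eq_left ((G.le_of_opNorm_le hG _).trans_eq ?_)
    rw [one_mul, i₀.norm_map]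
    rfl⟩
  have hι : ∀ a, ι.equivRange.symm ⟨ι a, a, rfl⟩ = a := ι.equivRange.symm_apply_apply
  let S : Γ →L[ℝ] 𝔾 := ContinuousLinearMap.snd ℝ A 𝔾 ∘L Γ.subtypeL
  obtain ⟨i, hi, hi1, hi2⟩ := hGC.exists_isometric_lift hD hG ι.range S
    (ContinuousLinearMap.opNorm_le_bound _ zero_le_one fun x => by
      rw [one_mul]
      exact norm_snd_le (x : A × 𝔾))
    (i₀.comp ι.equivRange.symm.toLinearIsometry) (by
      rintro ⟨_, a, rfl⟩
      exact (congrArg (fun b => G (i₀ b)) (hι a)).trans (hU₀ a)) hδ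
  refine ⟨i ∘L c, j, ⟨?_, ?_⟩, hj.mono (by linarith), fun a => ?_, hj₀,
    ?_⟩
  · refine hi.1.comp fun a b hab => ?_
    exact congrArg (fun x : Γ => (x : A × 𝔾).1) hab
  · intro a ha
    have h0 : 0 < ‖a‖ := norm_pos_iff.2 ha
    have h1 : (1 - δ) * ‖c a‖ ≤ ‖i (c a)‖ := hi.le_norm_apply (c a)
    have h2 : ‖i (c a)‖ ≤ (1 + δ) * ‖c a‖ := hi.norm_apply_le (c a)
    have h3 : (1 - δ) * ‖a‖ ≤ (1 - δ) * ‖c a‖ :=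
      mul_le_mul_of_nonneg_left (hc1 a) (by linarith)
    have h4 : (1 + δ) * ‖c a‖ ≤ (1 + δ) * ((1 + δ) * ‖a‖) :=
      mul_le_mul_of_nonneg_left (hc2 a) (by linarith)
    have h5 : δ * ‖a‖ ≤ ε / 3 * ‖a‖ := by gcongr
    have h6 : δ * (δ * ‖a‖) ≤ 1 / 3 * (δ * ‖a‖) := by gcongr
    have h7 : 0 < ε * ‖a‖ := by positivity
    have h8 : (1 - ε) * ‖a‖ < ‖i (c a)‖ := by linarith
    have h9 : ‖i (c a)‖ < (1 + ε) * ‖a‖ := by linarith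
    exact ⟨h8, h9⟩
  · exact (hi1 ⟨ι a, a, rfl⟩).trans (congrArg i₀ (hι a))
  · ext a
    exact hi2 (c a)

end GurariiOp

theorem mainTheorem4 {𝔾 : Type*} [NormedAddCommGroup 𝔾] [NormedSpace ℝ 𝔾] [CompleteSpace 𝔾]
    [TopologicalSpace.SeparableSpace 𝔾] (h𝔾 : GurariiOp.IsGurariiSpace 𝔾)
    (D : Set 𝔾) (hD : D.Countable) (hD' : Dense D) :
    Countable (GurariiOp.StandardTuple D) ∧
      ∀ G : 𝔾 →L[ℝ] 𝔾, ‖G‖ ≤ 1 →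
        (GurariiOp.IsGurariiOperator G ↔ GurariiOp.ConditionGC D G) :=
  ⟨GurariiOp.countable_standardTuple hD, fun _ hG =>
    ⟨fun h => h.conditionGC D, fun h => h.isGurariiOperator h𝔾 hD' hG⟩⟩
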